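/- **Setting.** For $d\in\mathbb N$, $d\ge 1$, $\lambda>1$ and $\tau_0>0$, let $\mathbf u\sim\mathcal N(0,I/d)$ in $\mathbb R^d$, and let $\mathbf W$ be an independent (normalized) GOE matrix: $\mathbf W$ is symmetric, its entries on and above the diagonal are independent, $\mathbf W_{ii}\sim\mathcal N(0,2/d)$ and $\mathbf W_{ij}\sim\mathcal N(0,1/d)$ for $i<j$. Put $$\mathbf M=\lambda\,\mathbf u\mathbf u^\top+\mathbf W,\qquad \mathbf A=\bigl(2(\lambda+\lambda^{-1})-2\bigr)I-\mathbf M,\qquad \mathbf b\mid\mathbf W,\mathbf u\;\sim\;\mathcal N(\sqrt{\tau_0}\,\mathbf u,\,I/d).$$ A randomized query algorithm (RQA) with query complexity $T$ receives $\mathbf b$; in each round $i=1,\dots,T$ it chooses a query $v^{(i)}\in\mathbb R^d$ and receives $w^{(i)}=\mathbf A v^{(i)}$; after round $T$ it returns $\hat x\in\mathbb R^d$. Here $v^{(i)}$ is a (measurable) function of $\mathbf b$, of $(v^{(j)},w^{(j)})_{j<i}$ and of a random seed $\boldsymbol\xi$, and $\hat x$ is a (measurable) function of $\mathbf b$, of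 $(v^{(j)},w^{(j)})_{j\le T}$ and of $\boldsymbol\xi$; the seed is independent of $(\mathbf u,\mathbf W,\mathbf b)$ and may have any law on any measurable space. Write $\mathrm{unit}(x)=x/\|x\|$ for $x\neq0$ and $\mathrm{unit}(0)=0$. **Theorem.** There are universal constants $c_1,c_2,c_3,c_4>0$ such that for every $\lambda\in(1,\tfrac32]$, with $\tau_0=(\lambda-1)^2$, every $d\ge1$, every integer $T$ with $1\le T\le\frac{1}{5(\lambda-1)}$, and every RQA with query complexity $T$ interacting with the instance $(\mathbf A,\mathbf b)$, $$\Pr\Bigl[\langle \mathrm{unit}(\hat x),\mathbf u\rangle^2>2e\,\tau_0\,T\Bigr]\;\le\;c_4\exp\bigl(-c_1\,d^{\,c_2}(\lambda-1)^{c_3}\bigr),$$ where the probability is over $\mathbf u,\mathbf W,\mathbf b$ and the seed of the algorithm. -/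

import Mathlib

open MeasureTheory ProbabilityTheory
open scoped NNReal ENNReal

noncomputable section

/-- A randomized query algorithm in dimension `d` with query complexity `T` and random seed taking
values in `Ξ`. Rounds are indexed by `i : Fin T`; before round `i` the algorithm holds the input
vector `b`, the `i` previous query-response pairs `(v, w)` and the seed. -/
structure RQA (d T : ℕ) (Ξ : Type*) [MeasurableSpace Ξ] where
  /-- the query made in round `i` -/
  query : (i : Fin T) → EuclideanSpace ℝ (Fin d) →
    (Fin (i : ℕ) → EuclideanSpace ℝ (Fin d) × EuclideanSpace ℝ (Fin d)) → Ξ →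
      EuclideanSpace ℝ (Fin d)
  /-- the vector returned after the last round -/
  output : EuclideanSpace ℝ (Fin d) →
    (Fin T → EuclideanSpace ℝ (Fin d) × EuclideanSpace ℝ (Fin d)) → Ξ →
      EuclideanSpace ℝ (Fin d)
  measurable_query : ∀ i : Fin T, Measurable
    (fun p : EuclideanSpace ℝ (Fin d) ×
      (Fin (i : ℕ) → EuclideanSpace ℝ (Fin d) × EuclideanSpace ℝ (Fin d)) × Ξ =>
        query i p.1 p.2.1 p.2.2)
  measurable_output : Measurable
    (fun p : EuclideanSpace ℝ (Fin d) ×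
      (Fin T → EuclideanSpace ℝ (Fin d) × EuclideanSpace ℝ (Fin d)) × Ξ =>
        output p.1 p.2.1 p.2.2)

namespace RQA

variable {d T : ℕ} {Ξ : Type*} [MeasurableSpace Ξ]

/-- The first `k` query-response pairs `(v, A v)` when `Alg` with seed `ξ` interacts with the
instance `(A, b)`. -/
def history (Alg : RQA d T Ξ) (A : Matrix (Fin d) (Fin d) ℝ) (b : EuclideanSpace ℝ (Fin d))
    (ξ : Ξ) : (k : ℕ) → k ≤ T → Fin k → EuclideanSpace ℝ (Fin d) × EuclideanSpace ℝ (Fin d)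
  | 0, _ => Fin.elim0
  | k + 1, hk =>
    Fin.snoc (α := fun _ => EuclideanSpace ℝ (Fin d) × EuclideanSpace ℝ (Fin d))
      (history Alg A b ξ k (Nat.le_of_succ_le hk))
      (Alg.query ⟨k, hk⟩ b (history Alg A b ξ k (Nat.le_of_succ_le hk)) ξ,
        Matrix.toEuclideanLin A
          (Alg.query ⟨k, hk⟩ b (history Alg A b ξ k (Nat.le_of_succ_le hk)) ξ))

/-- The output of `Alg` with seed `ξ` after its `T` rounds of interaction with `(A, b)`. -/
def run (Alg : RQA d T Ξ) (A : Matrix (Fin d) (Fin d) ℝ) (b : EuclideanSpace ℝ (Fin d))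
    (ξ : Ξ) : EuclideanSpace ℝ (Fin d) :=
  Alg.output b (Alg.history A b ξ T le_rfl) ξ

end RQA

/-- The unit vector `x / ‖x‖`, and `0` for `x = 0`. -/
def unitVec {d : ℕ} (x : EuclideanSpace ℝ (Fin d)) : EuclideanSpace ℝ (Fin d) :=
  ‖x‖⁻¹ • x

/-- The isotropic Gaussian law `N(m, I / d)` on `ℝ^d`. -/
def isoGaussian (d : ℕ) (m : EuclideanSpace ℝ (Fin d)) : Measure (EuclideanSpace ℝ (Fin d)) :=
  multivariateGaussian m ((d : ℝ)⁻¹ • (1 : Matrix (Fin d) (Fin d) ℝ))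

/-- The law of a normalized GOE matrix: symmetric, with independent entries on and above the
diagonal, `N(0, 2 / d)` on the diagonal and `N(0, 1 / d)` off the diagonal. A matrix is read as the
function of its two indices. -/
def goe (d : ℕ) : Measure (Fin d → Fin d → ℝ) :=
  (Measure.pi fun p : {p : Fin d × Fin d // p.1 ≤ p.2} =>
    gaussianReal 0 (if p.1.1 = p.1.2 then 2 / (d : ℝ≥0) else 1 / (d : ℝ≥0))).map
      fun g i j => g ⟨(min i j, max i j), min_le_max⟩

lemma isoGaussian_eq_map (d : ℕ) (m : EuclideanSpace ℝ (Fin d)) :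
    isoGaussian d m = (isoGaussian d 0).map (fun z => m + z) := by
  unfold isoGaussian multivariateGaussian
  rw [Measure.map_map (by fun_prop) (by fun_prop)]
  congr 1
  ext z : 1
  simp

instance (d : ℕ) (m : EuclideanSpace ℝ (Fin d)) : IsProbabilityMeasure (isoGaussian d m) := by
  unfold isoGaussian; infer_instance

instance (d : ℕ) : IsProbabilityMeasure (goe d) := by
  unfold goe
  exact Measure.isProbabilityMeasure_map (Measurable.aemeasurable (by fun_prop))

/-- The conditional law of the side information: given `(u, W)`, it is `N(√τ₀ u, I / d)`. -/
def sideInfo (d : ℕ) (τ₀ : ℝ) :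
    Kernel (EuclideanSpace ℝ (Fin d) × (Fin d → Fin d → ℝ)) (EuclideanSpace ℝ (Fin d)) where
  toFun p := isoGaussian d (Real.sqrt τ₀ • p.1)
  measurable' := by
    refine Measure.measurable_of_measurable_coe _ fun s hs => ?_
    have h : ∀ p : EuclideanSpace ℝ (Fin d) × (Fin d → Fin d → ℝ),
        isoGaussian d (Real.sqrt τ₀ • p.1) s =
          ∫⁻ z, s.indicator 1 (Real.sqrt τ₀ • p.1 + z) ∂(isoGaussian d 0) := by
      intro p
      rw [isoGaussian_eq_map, ← lintegral_indicator_one hs,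
        lintegral_map (measurable_one.indicator hs) (by fun_prop)]
    simp_rw [h]
    refine Measurable.lintegral_prod_right' (f := fun q :
      (EuclideanSpace ℝ (Fin d) × (Fin d → Fin d → ℝ)) × EuclideanSpace ℝ (Fin d) =>
        s.indicator (1 : EuclideanSpace ℝ (Fin d) → ℝ≥0∞) (Real.sqrt τ₀ • q.1.1 + q.2)) ?_
    exact (measurable_one.indicator hs).comp (by fun_prop)

instance (d : ℕ) (τ₀ : ℝ) : IsMarkovKernel (sideInfo d τ₀) :=
  ⟨fun p => inferInstanceAs (IsProbabilityMeasure (isoGaussian d (Real.sqrt τ₀ • p.1)))⟩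

/-- The joint law of `((u, W), b)`: the plant `u ~ N(0, I / d)` and the GOE matrix `W` are
independent, and `b` given `(u, W)` is `N(√τ₀ u, I / d)`. -/
def modelLaw (d : ℕ) (τ₀ : ℝ) :
    Measure ((EuclideanSpace ℝ (Fin d) × (Fin d → Fin d → ℝ)) × EuclideanSpace ℝ (Fin d)) :=
  ((isoGaussian d 0).prod (goe d)) ⊗ₘ sideInfo d τ₀

/-- The deformed Wigner matrix `M = lam • u uᵀ + W`. -/
def deformedWigner {d : ℕ} (lam : ℝ) (u : EuclideanSpace ℝ (Fin d)) (W : Fin d → Fin d → ℝ) :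
    Matrix (Fin d) (Fin d) ℝ :=
  lam • Matrix.vecMulVec (fun i => u i) (fun i => u i) + Matrix.of W

/-- The matrix `A = (2 (lam + lam⁻¹) - 2) I - M` which the algorithm queries. -/
def instanceMatrix {d : ℕ} (lam : ℝ) (u : EuclideanSpace ℝ (Fin d)) (W : Fin d → Fin d → ℝ) :
    Matrix (Fin d) (Fin d) ℝ :=
  (2 * (lam + lam⁻¹) - 2) • (1 : Matrix (Fin d) (Fin d) ℝ) - deformedWigner lam u W

end

/-! The algorithm only sees the plant through a Gaussian shift, and as long as its queries capture
little of the plant, that shift is almost invisible to it. With standard Gaussians `x`, `z`, `G`,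
the plant is `x / √d`, the side information is `(z + √τ₀ x) / √d`, and `W` is the symmetrization of
the matrix `G` with independent entries. The spike becomes a shift of `G` by a multiple of `x xᵀ`.
Fix the seed and count the output as query number `T` (from zero). The quantity to control is the
energy of `x` in the span of the first `k` queries, `spanEnergy`. If `Q` projects onto the
complement of those queries, they and their responses, hence also the next query, depend on `G` only
through `G - Q G Q` (`Nonanticipating`). The hidden part `Q G Q` can be redrawn without changing the
law (`Nonanticipating.lintegral_resample`). The likelihood ratio of the spike can therefore be
computed on the revealed part alone (`Nonanticipating.lintegral_add`), and its size is governed by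
the current energy (`norm_sq_sub_compress_outerSq_le`). Without the shifts, `x` is independent of
all queries and its energy in `k + 1` directions has chi-square tails. A change of measure, with the
likelihood ratio truncated at `exp θ`, carries this over to the shifted model
(`lintegral_jumpEvent_le`). With `δ = lam - 1`, an energy level `τ` (in units of `d`) grows in one
round to little more than `δ² + (1 + δ)² τ`. Iterating from zero gives `energyLevel δ k = δ² k exp
(5 δ / 2) ^ k`, which for `T ≤ 1 / (5 δ)` stays below `2 e δ² T` up to round `T + 1`. A union bound
over the rounds and the seed average finish the proof. -/

/-! ### Gaussian tools: resampling, Cameron–Martin, chi-square tails. -/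

section StdGaussian

variable {E : Type*} [NormedAddCommGroup E] [InnerProductSpace ℝ E] [FiniteDimensional ℝ E]
  [MeasurableSpace E] [BorelSpace E]

/-- Replacing the component of a standard Gaussian vector in the range of an orthogonal projection
by that of an independent copy does not change its law. -/
lemma map_resample_stdGaussian (P : E →L[ℝ] E) (hP : ∀ x y, inner ℝ (P x) y = inner ℝ x (P y))
    (hPP : ∀ x, P (P x) = P x) :
    ((stdGaussian E).prod (stdGaussian E)).map (fun p => p.1 - P p.1 + P p.2) = stdGaussian E := by
  have hm : Measurable (fun p : E × E => p.1 - P p.1 + P p.2) := by fun_prop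
  have := Measure.isProbabilityMeasure_map (μ := (stdGaussian E).prod (stdGaussian E))
    hm.aemeasurable
  apply Measure.ext_of_charFun
  ext t
  rw [charFun_apply, integral_map hm.aemeasurable (by fun_prop)]
  have h1 : ∀ p : E × E, Complex.exp ((inner ℝ (p.1 - P p.1 + P p.2) t : ℝ) * Complex.I) =
      Complex.exp ((inner ℝ p.1 (t - P t) : ℝ) * Complex.I) *
        Complex.exp ((inner ℝ p.2 (P t) : ℝ) * Complex.I) := by
    intro p
    rw [← Complex.exp_add, inner_add_left, inner_sub_left, hP, hP, inner_sub_right]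
    push_cast
    ring_nf
  simp_rw [h1]
  rw [integral_prod_mul (fun x : E => Complex.exp ((inner ℝ x (t - P t) : ℝ) * Complex.I))
    (fun x : E => Complex.exp ((inner ℝ x (P t) : ℝ) * Complex.I)), ← charFun_apply,
    ← charFun_apply, charFun_stdGaussian, charFun_stdGaussian, charFun_stdGaussian,
    ← Complex.exp_add]
  congr 1
  -- Pythagoras for an orthogonal projection recombines the two characteristic exponents into that
  -- of a single Gaussian.
  have h2 : ‖t - P t‖ ^ 2 + ‖P t‖ ^ 2 = ‖t‖ ^ 2 := by
    rw [@norm_sub_sq_real, ← real_inner_self_eq_norm_sq (P t), hP t (P t), hPP]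
    ring
  rw [← Complex.ofReal_pow, ← Complex.ofReal_pow, ← Complex.ofReal_pow, ← h2]
  push_cast
  ring

lemma integrable_exp_inner_stdGaussian (m : E) :
    Integrable (fun x => Real.exp (inner ℝ x m)) (stdGaussian E) := by
  have h : Integrable (fun x : ℝ => Real.exp (1 * x))
      ((stdGaussian E).map (innerSL ℝ m)) := by
    rw [IsGaussian.map_eq_gaussianReal]
    exact integrable_exp_mul_gaussianReal 1
  rw [integrable_map_measure (by fun_prop) (by fun_prop)] at h
  refine h.congr (.of_forall fun x => ?_)
  simp [real_inner_comm]

/-- This is the unnormalized characteristic function of the exponentially tilted Gaussian, as needed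
for Cameron–Martin. An orthonormal basis splits it into one-dimensional complex moment generating
functions. -/
lemma integral_cexp_inner_stdGaussian (m t : E) :
    ∫ x, Complex.exp ((inner ℝ x m : ℝ) + (inner ℝ x t : ℝ) * Complex.I) ∂(stdGaussian E) =
      Complex.exp (‖m‖ ^ 2 / 2 - ‖t‖ ^ 2 / 2 + (inner ℝ m t : ℝ) * Complex.I) := by
  set b := stdOrthonormalBasis ℝ E
  rw [stdGaussian_eq_map_pi_orthonormalBasis b, integral_map (Measurable.aemeasurable (by fun_prop))
    (Measurable.aestronglyMeasurable (by fun_prop))]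
  have h1 : ∀ x : Fin (Module.finrank ℝ E) → ℝ,
      Complex.exp ((inner ℝ (∑ i, x i • b i) m : ℝ) +
        (inner ℝ (∑ i, x i • b i) t : ℝ) * Complex.I) =
      ∏ i, Complex.exp
        (((inner ℝ (b i) m : ℝ) + (inner ℝ (b i) t : ℝ) * Complex.I) * (x i : ℝ)) := by
    intro x
    rw [← Complex.exp_sum, sum_inner, sum_inner]
    push_cast
    rw [Finset.sum_mul, ← Finset.sum_add_distrib]
    congr 1
    refine Finset.sum_congr rfl fun i _ => ?_
    rw [real_inner_smul_left, real_inner_smul_left]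
    push_cast
    ring
  simp_rw [h1]
  rw [integral_fintype_prod_eq_prod (f := fun i (y : ℝ) =>
    Complex.exp (((inner ℝ (b i) m : ℝ) + (inner ℝ (b i) t : ℝ) * Complex.I) * (y : ℝ)))]
  have h2 : ∀ z : ℂ, ∫ y : ℝ, Complex.exp (z * (y : ℝ)) ∂(gaussianReal 0 1) =
      Complex.exp (z ^ 2 / 2) := by
    intro z
    have := complexMGF_id_gaussianReal (μ := 0) (v := 1) z
    simpa [complexMGF] using this
  simp_rw [h2]
  rw [← Complex.exp_sum]
  congr 1
  rw [← b.sum_inner_mul_inner m t, ← Complex.ofReal_pow, ← Complex.ofReal_pow,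
    ← b.sum_sq_inner_right m, ← b.sum_sq_inner_right t]
  push_cast
  rw [Finset.sum_div, Finset.sum_div, Finset.sum_mul, ← Finset.sum_sub_distrib,
    ← Finset.sum_add_distrib]
  refine Finset.sum_congr rfl fun i _ => ?_
  rw [real_inner_comm (b i) m]
  ring_nf
  rw [Complex.I_sq]
  ring

/-- The Cameron–Martin formula for the standard Gaussian measure. -/
lemma map_add_stdGaussian (m : E) :
    (stdGaussian E).map (fun x => x + m) = (stdGaussian E).withDensity
      (fun x => ENNReal.ofReal (Real.exp (inner ℝ x m - ‖m‖ ^ 2 / 2))) := by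
  have hi : Integrable (fun x => Real.exp (inner ℝ x m - ‖m‖ ^ 2 / 2)) (stdGaussian E) := by
    simp_rw [Real.exp_sub]
    exact (integrable_exp_inner_stdGaussian m).div_const _
  have := isFiniteMeasure_withDensity_ofReal hi.2
  have hm : Measurable (fun x : E => x + m) := by fun_prop
  have := Measure.isProbabilityMeasure_map (μ := stdGaussian E) hm.aemeasurable
  apply Measure.ext_of_charFun
  ext t
  rw [charFun_apply, charFun_apply, integral_map hm.aemeasurable (by fun_prop),
    integral_withDensity_eq_integral_toReal_smul (by fun_prop) (by simp)]
  have h1 : ∀ x : E, (ENNReal.ofReal (Real.exp (inner ℝ x m - ‖m‖ ^ 2 / 2))).toReal •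
      Complex.exp ((inner ℝ x t : ℝ) * Complex.I) = Complex.exp (-‖m‖ ^ 2 / 2) *
        Complex.exp ((inner ℝ x m : ℝ) + (inner ℝ x t : ℝ) * Complex.I) := by
    intro x
    rw [ENNReal.toReal_ofReal (Real.exp_nonneg _), Complex.real_smul, Complex.ofReal_exp,
      ← Complex.exp_add, ← Complex.exp_add]
    push_cast
    ring_nf
  have h2 : ∀ x : E, Complex.exp ((inner ℝ (x + m) t : ℝ) * Complex.I) =
      Complex.exp ((inner ℝ m t : ℝ) * Complex.I) *
        Complex.exp ((inner ℝ x t : ℝ) * Complex.I) := by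
    intro x
    rw [← Complex.exp_add, inner_add_left]
    push_cast
    ring_nf
  simp_rw [h1, h2]
  rw [integral_const_mul, integral_const_mul, integral_cexp_inner_stdGaussian, ← charFun_apply,
    charFun_stdGaussian, ← Complex.exp_add, ← Complex.exp_add]
  ring_nf

lemma lintegral_add_stdGaussian (m : E) {f : E → ℝ≥0∞} (hf : Measurable f) :
    ∫⁻ x, f (x + m) ∂(stdGaussian E) =
      ∫⁻ x, ENNReal.ofReal (Real.exp (inner ℝ x m - ‖m‖ ^ 2 / 2)) * f x ∂(stdGaussian E) := by
  rw [← lintegral_map hf (by fun_prop), map_add_stdGaussian,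
    lintegral_withDensity_eq_lintegral_mul _ (by fun_prop) hf]
  rfl

lemma lintegral_exp_inner_stdGaussian (m : E) :
    ∫⁻ x, ENNReal.ofReal (Real.exp (inner ℝ x m)) ∂(stdGaussian E) =
      ENNReal.ofReal (Real.exp (‖m‖ ^ 2 / 2)) := by
  have h := lintegral_add_stdGaussian m (f := fun _ => 1) measurable_const
  simp only [lintegral_const, measure_univ, mul_one] at h
  have h1 : ∀ x : E, ENNReal.ofReal (Real.exp (inner ℝ x m)) =
      ENNReal.ofReal (Real.exp (‖m‖ ^ 2 / 2)) *
        ENNReal.ofReal (Real.exp (inner ℝ x m - ‖m‖ ^ 2 / 2)) := by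
    intro x
    rw [← ENNReal.ofReal_mul (Real.exp_nonneg _), ← Real.exp_add]
    ring_nf
  simp_rw [h1]
  rw [lintegral_const_mul _ (by fun_prop), ← h, mul_one]

lemma lintegral_resample_stdGaussian (P : E →L[ℝ] E)
    (hP : ∀ x y, inner ℝ (P x) y = inner ℝ x (P y)) (hPP : ∀ x, P (P x) = P x)
    {f : E → ℝ≥0∞} (hf : Measurable f) :
    ∫⁻ x, ∫⁻ y, f (x - P x + P y) ∂(stdGaussian E) ∂(stdGaussian E) =
      ∫⁻ x, f x ∂(stdGaussian E) := by
  conv_rhs => rw [← map_resample_stdGaussian P hP hPP, lintegral_map hf (by fun_prop)]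
  rw [lintegral_prod _ (by fun_prop)]

lemma lintegral_exp_sq_gaussianReal {s : ℝ} (hs : s < 1) :
    ∫⁻ y, ENNReal.ofReal (Real.exp (s * y ^ 2 / 2)) ∂(gaussianReal 0 1) =
      ENNReal.ofReal (Real.sqrt (1 - s))⁻¹ := by
  have h1 : 0 < (1 - s) / 2 := by linarith
  rw [gaussianReal_of_var_ne_zero _ one_ne_zero,
    lintegral_withDensity_eq_lintegral_mul _ (measurable_gaussianPDF _ _) (by fun_prop)]
  have h2 : ∀ y : ℝ, (gaussianPDF 0 1 * fun y : ℝ => ENNReal.ofReal (Real.exp (s * y ^ 2 / 2))) y =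
      ENNReal.ofReal ((Real.sqrt (2 * Real.pi))⁻¹ * Real.exp (-((1 - s) / 2) * y ^ 2)) := by
    intro y
    rw [Pi.mul_apply, gaussianPDF, ← ENNReal.ofReal_mul (gaussianPDFReal_nonneg _ _ _),
      gaussianPDFReal, mul_assoc, ← Real.exp_add]
    congr 2
    · simp
    · congr 1
      simp
      ring
  simp_rw [h2]
  rw [← ofReal_integral_eq_lintegral_ofReal
    ((integrable_exp_neg_mul_sq h1).const_mul _) (.of_forall fun y => by positivity),
    integral_const_mul, integral_gaussian]
  congr 1
  rw [← Real.sqrt_inv, ← Real.sqrt_mul (by positivity), ← Real.sqrt_inv]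
  congr 1
  have := Real.pi_pos
  have : 1 - s ≠ 0 := by linarith
  field_simp

/-- The zero vector is admitted because a Gram–Schmidt direction vanishes when a query lies in the
span of its predecessors. -/
lemma lintegral_exp_inner_sq_stdGaussian_le {s : ℝ} (hs0 : 0 ≤ s) (hs : s < 1) {e : E}
    (he : ‖e‖ = 0 ∨ ‖e‖ = 1) :
    ∫⁻ x, ENNReal.ofReal (Real.exp (s * (inner ℝ e x) ^ 2 / 2)) ∂(stdGaussian E) ≤
      ENNReal.ofReal (Real.sqrt (1 - s))⁻¹ := by
  rcases he with he | he
  · rw [norm_eq_zero] at he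
    subst he
    simp only [inner_zero_left, ne_eq, OfNat.ofNat_ne_zero, not_false_eq_true, zero_pow, mul_zero,
      zero_div, Real.exp_zero, ENNReal.ofReal_one, lintegral_const, measure_univ, mul_one]
    rw [← ENNReal.ofReal_one]
    refine ENNReal.ofReal_le_ofReal ?_
    refine (one_le_inv₀ (Real.sqrt_pos.2 (by linarith))).2 ?_
    exact Real.sqrt_le_one.2 (by linarith)
  · have h : (stdGaussian E).map (innerSL ℝ e) = gaussianReal 0 1 := by
      rw [IsGaussian.map_eq_gaussianReal, variance_dual_stdGaussian, innerSL_apply_norm, he,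
        integral_strongDual_stdGaussian]
      simp
    rw [← lintegral_exp_sq_gaussianReal hs, ← h, lintegral_map (by fun_prop) (by fun_prop)]
    simp

/-- The square exponential moments of the coordinates of a standard Gaussian vector along a family
of orthogonal vectors, each of norm zero or one. -/
lemma lintegral_exp_sum_inner_sq_stdGaussian_le {ι : Type*} {s : ℝ} (hs0 : 0 ≤ s) (hs : s < 1)
    (e : ι → E) (he : ∀ i, ‖e i‖ = 0 ∨ ‖e i‖ = 1)
    (horth : ∀ i j, i ≠ j → inner ℝ (e i) (e j) = 0) (S : Finset ι) :
    ∫⁻ x, ENNReal.ofReal (Real.exp (s * (∑ j ∈ S, (inner ℝ (e j) x) ^ 2) / 2)) ∂(stdGaussian E) ≤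
      ENNReal.ofReal (Real.sqrt (1 - s))⁻¹ ^ S.card := by
  classical
  induction S using Finset.induction_on with
  | empty => simp
  | insert a S ha ih =>
    set P : E →L[ℝ] E := (innerSL ℝ (e a)).smulRight (e a) with hPdef
    have hPa : ∀ x, P x = inner ℝ (e a) x • e a := fun x => by simp [hPdef]
    have hP : ∀ x y, inner ℝ (P x) y = inner ℝ x (P y) := by
      intro x y
      rw [hPa, hPa, real_inner_smul_left, real_inner_smul_right, real_inner_comm (e a) x]
      ring
    have hea : inner ℝ (e a) (e a) • e a = e a := by
      rw [real_inner_self_eq_norm_sq]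
      rcases he a with h | h
      · rw [norm_eq_zero] at h; simp [h]
      · simp [h]
    have hPP : ∀ x, P (P x) = P x := by
      intro x
      rw [hPa (P x), hPa x, real_inner_smul_right, mul_smul, hea]
    -- Redrawing the component along `e a` makes it independent of the others, which are orthogonal
    -- to `e a` and so unaffected; the integral factors.
    rw [← lintegral_resample_stdGaussian P hP hPP (by fun_prop)]
    have h1 : ∀ x y, inner ℝ (e a) (x - P x + P y) = inner ℝ (e a) y := by
      intro x y
      have h2 : ∀ z, inner ℝ (e a) (P z) = inner ℝ (e a) z := by
        intro z
        have : P (e a) = e a := by rw [hPa, hea]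
        rw [← hP, this]
      rw [inner_add_right, inner_sub_right, h2, h2]
      ring
    have h3 : ∀ x y, ∀ j ∈ S, inner ℝ (e j) (x - P x + P y) = inner ℝ (e j) x := by
      intro x y j hj
      have : inner ℝ (e j) (e a) = 0 := horth j a (by rintro rfl; exact ha hj)
      rw [inner_add_right, inner_sub_right, hPa, hPa, real_inner_smul_right,
        real_inner_smul_right, this]
      ring
    have h4 : ∀ x y, ENNReal.ofReal (Real.exp
        (s * (∑ j ∈ insert a S, (inner ℝ (e j) (x - P x + P y)) ^ 2) / 2)) =
        ENNReal.ofReal (Real.exp (s * (∑ j ∈ S, (inner ℝ (e j) x) ^ 2) / 2)) *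
          ENNReal.ofReal (Real.exp (s * (inner ℝ (e a) y) ^ 2 / 2)) := by
      intro x y
      rw [Finset.sum_insert ha, h1, Finset.sum_congr rfl (fun j hj => by rw [h3 x y j hj]),
        ← ENNReal.ofReal_mul (Real.exp_nonneg _), ← Real.exp_add]
      ring_nf
    simp_rw [h4]
    have h5 : ∀ x : E, ∫⁻ y, ENNReal.ofReal (Real.exp (s * (∑ j ∈ S, (inner ℝ (e j) x) ^ 2) / 2)) *
          ENNReal.ofReal (Real.exp (s * (inner ℝ (e a) y) ^ 2 / 2)) ∂(stdGaussian E) =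
        ENNReal.ofReal (Real.exp (s * (∑ j ∈ S, (inner ℝ (e j) x) ^ 2) / 2)) *
          ∫⁻ y, ENNReal.ofReal (Real.exp (s * (inner ℝ (e a) y) ^ 2 / 2)) ∂(stdGaussian E) :=
      fun x => lintegral_const_mul _ (by fun_prop)
    simp_rw [h5]
    rw [lintegral_mul_const _ (by fun_prop), Finset.card_insert_of_notMem ha, pow_succ]
    exact mul_le_mul' ih (lintegral_exp_inner_sq_stdGaussian_le hs0 hs (he a))

/-- The Chernoff bound for a chi-square variable. The parameter `s` stays free, since the
application pushes it close to one. -/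
lemma stdGaussian_sum_inner_sq_gt_le {ι : Type*} {s : ℝ} (hs0 : 0 ≤ s) (hs : s < 1)
    (e : ι → E) (he : ∀ i, ‖e i‖ = 0 ∨ ‖e i‖ = 1)
    (horth : ∀ i j, i ≠ j → inner ℝ (e i) (e j) = 0) (S : Finset ι) (r : ℝ) :
    stdGaussian E {x | r < ∑ j ∈ S, (inner ℝ (e j) x) ^ 2} ≤
      ENNReal.ofReal ((Real.sqrt (1 - s))⁻¹ ^ S.card * Real.exp (-(s * r / 2))) := by
  have hmeas : MeasurableSet {x : E | r < ∑ j ∈ S, (inner ℝ (e j) x) ^ 2} :=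
    measurableSet_lt (by fun_prop) (by fun_prop)
  rw [← lintegral_indicator_one hmeas, ENNReal.ofReal_mul (by positivity),
    ENNReal.ofReal_pow (by positivity)]
  refine le_trans ?_ (mul_le_mul_left
    (lintegral_exp_sum_inner_sq_stdGaussian_le hs0 hs e he horth S) _)
  rw [← lintegral_mul_const _ (by fun_prop)]
  refine lintegral_mono fun x => ?_
  by_cases hx : r < ∑ j ∈ S, (inner ℝ (e j) x) ^ 2
  · rw [Set.indicator_of_mem (by exact hx), Pi.one_apply, ← ENNReal.ofReal_mul (Real.exp_nonneg _),
      ← Real.exp_add, ← ENNReal.ofReal_one]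
    refine ENNReal.ofReal_le_ofReal (Real.one_le_exp ?_)
    nlinarith
  · rw [Set.indicator_of_notMem (by exact hx)]
    exact zero_le

/-- The upper tail of the norm of a standard Gaussian vector. -/
lemma stdGaussian_norm_sq_gt_le {d : ℕ} {ε : ℝ} (hε0 : 0 ≤ ε) (hε : ε ≤ 1) :
    stdGaussian (EuclideanSpace ℝ (Fin d)) {x | (1 + ε) * d < ‖x‖ ^ 2} ≤
      ENNReal.ofReal (Real.exp (-(d * ε ^ 2 / 8))) := by
  -- The choice `s = ε / (1 + ε)` is the optimal Chernoff parameter at level `(1 + ε) d`.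
  have hs : 1 - ε / (1 + ε) = (1 + ε)⁻¹ := by field_simp; ring
  have hs1 : ε / (1 + ε) < 1 := by rw [div_lt_one (by linarith)]; linarith
  have h := stdGaussian_sum_inner_sq_gt_le (E := EuclideanSpace ℝ (Fin d))
    (s := ε / (1 + ε)) (by positivity) hs1 (fun i : Fin d => EuclideanSpace.basisFun (Fin d) ℝ i)
    (fun i => Or.inr (by simp)) (fun i j hij => by
      exact (EuclideanSpace.basisFun (Fin d) ℝ).orthonormal.2 hij) Finset.univ ((1 + ε) * d)
  simp_rw [OrthonormalBasis.sum_sq_inner_right] at h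
  refine h.trans (ENNReal.ofReal_le_ofReal ?_)
  rw [hs, Real.sqrt_inv, inv_inv, Finset.card_univ, Fintype.card_fin]
  have h1 : Real.sqrt (1 + ε) ≤ Real.exp (ε / 2 - ε ^ 2 / 8) := by
    rw [Real.sqrt_le_left (Real.exp_nonneg _), ← Real.exp_nat_mul]
    refine le_trans ?_ (Real.quadratic_le_exp_of_nonneg ?_)
    · push_cast
      nlinarith [mul_nonneg hε0 hε0, mul_nonneg hε0 (mul_nonneg hε0 hε0),
        mul_nonneg (mul_nonneg hε0 hε0) (sub_nonneg.2 hε),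
        pow_nonneg hε0 4]
    · push_cast
      nlinarith
  calc Real.sqrt (1 + ε) ^ d * Real.exp (-(ε / (1 + ε) * ((1 + ε) * d) / 2))
      ≤ Real.exp (ε / 2 - ε ^ 2 / 8) ^ d * Real.exp (-(ε / (1 + ε) * ((1 + ε) * d) / 2)) := by
        gcongr
    _ = Real.exp (-(d * ε ^ 2 / 8)) := by
        rw [← Real.exp_nat_mul, ← Real.exp_add]
        congr 1
        field_simp
        ring

end StdGaussian

/-! ### The model written in standard Gaussian coordinates. -/

section ModelLaw

/-- The coordinates of a standard Gaussian vector along orthogonal directions are independent. -/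
lemma map_inner_stdGaussian_eq_pi {E ι : Type*} [NormedAddCommGroup E] [InnerProductSpace ℝ E]
    [FiniteDimensional ℝ E] [MeasurableSpace E] [BorelSpace E] [Fintype ι] (a : ι → E)
    (ha : ∀ i j, i ≠ j → inner ℝ (a i) (a j) = 0) (v : ι → ℝ≥0) (hv : ∀ i, ‖a i‖ ^ 2 = v i) :
    (stdGaussian E).map (fun x i => inner ℝ (a i) x) =
      Measure.pi fun i => gaussianReal 0 (v i) := by
  set X : ι → E → ℝ := fun i x => inner ℝ (a i) x with hX
  have hlaw : HasGaussianLaw (fun x => (X · x)) (stdGaussian E) := by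
    have : (fun x : E => (X · x)) = ⇑(ContinuousLinearMap.pi fun i => innerSL ℝ (a i)) := by
      ext x i
      simp [hX]
    rw [this]
    exact ⟨inferInstance⟩
  have hind : iIndepFun X (stdGaussian E) := by
    refine hlaw.iIndepFun_of_covariance_eq_zero fun i j hij => ?_
    rw [← covarianceBilin_apply_eq_cov IsGaussian.memLp_two_id, covarianceBilin_stdGaussian]
    simpa using! ha i j hij
  rw [iIndepFun_iff_map_fun_eq_pi_map (fun i => by fun_prop)] at hind
  change (stdGaussian E).map (fun x i => X i x) = _
  rw [hind]
  congr 1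
  ext1 i
  have : X i = ⇑(innerSL ℝ (a i)) := by ext x; simp [hX]
  rw [this, IsGaussian.map_eq_gaussianReal, variance_dual_stdGaussian, innerSL_apply_norm,
    integral_strongDual_stdGaussian, hv]
  simp

lemma isoGaussian_eq_map_stdGaussian (d : ℕ) (m : EuclideanSpace ℝ (Fin d)) :
    isoGaussian d m = (stdGaussian (EuclideanSpace ℝ (Fin d))).map
      (fun x => m + (Real.sqrt d)⁻¹ • x) := by
  have hm : Measurable (fun x : EuclideanSpace ℝ (Fin d) => m + (Real.sqrt d)⁻¹ • x) := by fun_prop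
  have := Measure.isProbabilityMeasure_map (μ := stdGaussian (EuclideanSpace ℝ (Fin d)))
    hm.aemeasurable
  have hS : ((d : ℝ)⁻¹ • (1 : Matrix (Fin d) (Fin d) ℝ)).PosSemidef :=
    Matrix.PosSemidef.one.smul (by positivity)
  apply Measure.ext_of_charFun
  ext t
  rw [isoGaussian, charFun_multivariateGaussian hS, charFun_apply, integral_map hm.aemeasurable
    (by fun_prop)]
  have h1 : ∀ x : EuclideanSpace ℝ (Fin d),
      Complex.exp ((inner ℝ (m + (Real.sqrt d)⁻¹ • x) t : ℝ) * Complex.I) =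
      Complex.exp ((inner ℝ m t : ℝ) * Complex.I) *
        Complex.exp ((inner ℝ x ((Real.sqrt d)⁻¹ • t) : ℝ) * Complex.I) := by
    intro x
    rw [← Complex.exp_add, inner_add_left, real_inner_smul_left, real_inner_smul_right]
    push_cast
    ring_nf
  simp_rw [h1]
  rw [integral_const_mul, ← charFun_apply, charFun_stdGaussian, ← Complex.exp_add]
  have h2 : (t.ofLp ⬝ᵥ ((d : ℝ)⁻¹ • (1 : Matrix (Fin d) (Fin d) ℝ)).mulVec t.ofLp : ℝ) =
      ‖(Real.sqrt d)⁻¹ • t‖ ^ 2 := by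
    rw [norm_smul, mul_pow, EuclideanSpace.real_norm_sq_eq, Matrix.smul_mulVec, Matrix.one_mulVec,
      dotProduct_smul, norm_inv, inv_pow, Real.norm_of_nonneg (Real.sqrt_nonneg _),
      Real.sq_sqrt (by positivity)]
    simp [dotProduct, pow_two]
  rw [h2, real_inner_comm]
  push_cast
  ring_nf

/-- The symmetric matrix `(G + Gᵀ) / √(2 d)`. -/
noncomputable def symmetrize {d : ℕ} (G : EuclideanSpace ℝ (Fin d × Fin d)) :
    Fin d → Fin d → ℝ :=
  fun i j => (Real.sqrt (2 * d))⁻¹ * (G (i, j) + G (j, i))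

lemma measurable_symmetrize {d : ℕ} : Measurable (symmetrize (d := d)) := by
  unfold symmetrize
  fun_prop

/-- Lifting to a non-symmetric matrix gives an isotropic law on `ℝ^(d × d)`, where Cameron–Martin
and resampling along orthogonal projections apply directly. The entries of the symmetrization with
`i ≤ j` are inner products with orthogonal vectors. -/
lemma goe_eq_map_stdGaussian (d : ℕ) :
    goe d = (stdGaussian (EuclideanSpace ℝ (Fin d × Fin d))).map symmetrize := by
  set a : {p : Fin d × Fin d // p.1 ≤ p.2} → EuclideanSpace ℝ (Fin d × Fin d) := fun p =>
    (Real.sqrt (2 * d))⁻¹ • (EuclideanSpace.single p.1 1 + EuclideanSpace.single p.1.swap 1)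
    with ha
  have hinner : ∀ p G, inner ℝ (a p) G =
      (Real.sqrt (2 * d))⁻¹ * (G p.1 + G p.1.swap) := by
    intro p G
    simp only [ha]
    rw [real_inner_smul_left, inner_add_left, EuclideanSpace.inner_single_left,
      EuclideanSpace.inner_single_left]
    simp
  have horth : ∀ p q, p ≠ q → inner ℝ (a p) (a q) = 0 := by
    rintro ⟨⟨i, j⟩, hij⟩ ⟨⟨k, l⟩, hkl⟩ hpq
    rw [hinner]
    simp only [ne_eq, Subtype.mk.injEq, Prod.mk.injEq, not_and] at hpq hij hkl
    simp only [ha, Prod.swap_prod_mk, PiLp.smul_apply, PiLp.add_apply, PiLp.single_apply,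
      Prod.mk.injEq, smul_eq_mul]
    have h1 : ¬ (i = k ∧ j = l) := fun h => hpq h.1 h.2
    have h2 : ¬ (j = l ∧ i = k) := fun h => hpq h.2 h.1
    -- Both index pairs are ordered, so being transposes of each other forces them onto the
    -- diagonal, where they coincide.
    have h3 : ¬ (i = l ∧ j = k) := by
      rintro ⟨rfl, rfl⟩
      have := le_antisymm hij hkl
      exact h1 ⟨this, this.symm⟩
    have h4 : ¬ (j = k ∧ i = l) := fun h => h3 ⟨h.2, h.1⟩
    simp [h1, h2, h3, h4]
  have hnorm : ∀ p, ‖a p‖ ^ 2 =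
      ((if p.1.1 = p.1.2 then 2 / (d : ℝ≥0) else 1 / (d : ℝ≥0) : ℝ≥0) : ℝ) := by
    rintro ⟨⟨i, j⟩, hij⟩
    have hd : (0 : ℝ) < d := by exact_mod_cast i.pos
    rw [← real_inner_self_eq_norm_sq, hinner]
    simp only [ha, Prod.swap_prod_mk, PiLp.smul_apply, PiLp.add_apply, PiLp.single_apply,
      Prod.mk.injEq, smul_eq_mul, if_true]
    have hs : (Real.sqrt (2 * d))⁻¹ * (Real.sqrt (2 * d))⁻¹ = 1 / (2 * d) := by
      rw [← mul_inv, Real.mul_self_sqrt (by positivity), one_div]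
    by_cases h : i = j
    · subst h
      simp only [and_self, if_true, NNReal.coe_div, NNReal.coe_ofNat, NNReal.coe_natCast]
      linear_combination (norm := (field_simp; ring)) 4 * hs
    · have h' : ¬ j = i := fun h' => h h'.symm
      simp only [h, h', and_false, if_false, NNReal.coe_div, NNReal.coe_one, NNReal.coe_natCast]
      linear_combination (norm := (field_simp; ring)) 2 * hs
  rw [goe, ← map_inner_stdGaussian_eq_pi a horth _ hnorm, Measure.map_map (by fun_prop)
    (by fun_prop)]
  congr 1
  ext G i j
  simp only [Function.comp_apply, hinner, symmetrize]
  rcases le_total i j with h | h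
  · simp [h]
  · simp [h, add_comm]

lemma lintegral_modelLaw (d : ℕ) (τ₀ : ℝ)
    {f : (EuclideanSpace ℝ (Fin d) × (Fin d → Fin d → ℝ)) × EuclideanSpace ℝ (Fin d) → ℝ≥0∞}
    (hf : Measurable f) :
    ∫⁻ ω, f ω ∂(modelLaw d τ₀) =
      ∫⁻ x, ∫⁻ G, ∫⁻ z, f (((Real.sqrt d)⁻¹ • x, symmetrize G),
          (Real.sqrt d)⁻¹ • (z + Real.sqrt τ₀ • x))
        ∂(stdGaussian (EuclideanSpace ℝ (Fin d)))
        ∂(stdGaussian (EuclideanSpace ℝ (Fin d × Fin d)))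
        ∂(stdGaussian (EuclideanSpace ℝ (Fin d))) := by
  have hk : ∀ p : EuclideanSpace ℝ (Fin d) × (Fin d → Fin d → ℝ),
      ∫⁻ b, f (p, b) ∂(sideInfo d τ₀ p) =
        ∫⁻ z, f (p, Real.sqrt τ₀ • p.1 + (Real.sqrt d)⁻¹ • z)
          ∂(stdGaussian (EuclideanSpace ℝ (Fin d))) := by
    intro p
    change ∫⁻ b, f (p, b) ∂(isoGaussian d (Real.sqrt τ₀ • p.1)) = _
    rw [isoGaussian_eq_map_stdGaussian, lintegral_map (by fun_prop) (by fun_prop)]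
  rw [modelLaw, Measure.lintegral_compProd hf]
  simp_rw [hk]
  have hm : Measurable fun p : EuclideanSpace ℝ (Fin d) × (Fin d → Fin d → ℝ) =>
      ∫⁻ z, f (p, Real.sqrt τ₀ • p.1 + (Real.sqrt d)⁻¹ • z)
          ∂(stdGaussian (EuclideanSpace ℝ (Fin d))) := by
    refine Measurable.lintegral_prod_right' (f := fun q :
      (EuclideanSpace ℝ (Fin d) × (Fin d → Fin d → ℝ)) × EuclideanSpace ℝ (Fin d) =>
        f (q.1, Real.sqrt τ₀ • q.1.1 + (Real.sqrt d)⁻¹ • q.2)) ?_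
    fun_prop
  rw [lintegral_prod _ hm.aemeasurable, isoGaussian_eq_map_stdGaussian, goe_eq_map_stdGaussian,
    lintegral_map (Measurable.lintegral_prod_right' hm) (by fun_prop)]
  refine lintegral_congr fun x => ?_
  have hmx := hm.comp (measurable_prodMk_left (x := 0 + (Real.sqrt d)⁻¹ • x))
  refine (lintegral_map hmx measurable_symmetrize).trans ?_
  refine lintegral_congr fun G => lintegral_congr fun z => ?_
  rw [zero_add, smul_add, smul_comm (Real.sqrt d)⁻¹ (Real.sqrt τ₀) x,
    add_comm ((Real.sqrt d)⁻¹ • z)]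

end ModelLaw

/-! ### Gram–Schmidt projections and the captured energy. -/

section GramSchmidt

variable {d : ℕ}

lemma norm_unitVec (x : EuclideanSpace ℝ (Fin d)) : ‖unitVec x‖ = 0 ∨ ‖unitVec x‖ = 1 := by
  unfold unitVec
  rcases eq_or_ne x 0 with rfl | hx
  · simp
  · right
    rw [norm_smul, norm_inv, norm_norm, inv_mul_cancel₀ (norm_ne_zero_iff.2 hx)]

lemma measurable_unitVec : Measurable (unitVec (d := d)) := by
  unfold unitVec
  fun_prop

lemma inner_toEuclideanLin_left (A : Matrix (Fin d) (Fin d) ℝ) (x y : EuclideanSpace ℝ (Fin d)) :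
    inner ℝ (Matrix.toEuclideanLin A x) y = inner ℝ x (Matrix.toEuclideanLin A.transpose y) := by
  have := LinearMap.adjoint_inner_right (Matrix.toEuclideanLin A) x y
  rw [← Matrix.toEuclideanLin_conjTranspose_eq_adjoint, Matrix.conjTranspose_eq_transpose_of_trivial]
    at this
  exact this.symm

lemma toEuclideanLin_mul_apply (A B : Matrix (Fin d) (Fin d) ℝ) (x : EuclideanSpace ℝ (Fin d)) :
    Matrix.toEuclideanLin (A * B) x = Matrix.toEuclideanLin A (Matrix.toEuclideanLin B x) := by
  simp [Matrix.toLpLin_apply, Matrix.mulVec_mulVec]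

lemma toEuclideanLin_vecMulVec (e x : EuclideanSpace ℝ (Fin d)) :
    Matrix.toEuclideanLin (Matrix.vecMulVec e e) x = inner ℝ e x • e := by
  ext i
  simp [Matrix.toLpLin_apply, Matrix.vecMulVec_mulVec, PiLp.inner_apply, dotProduct, mul_comm]

/-- The projection onto the orthogonal complement of the first `k` vectors of a sequence, obtained
by Gram–Schmidt orthogonalization. -/
noncomputable def residualProj (q : ℕ → EuclideanSpace ℝ (Fin d)) : ℕ → Matrix (Fin d) (Fin d) ℝ
  | 0 => 1
  | k + 1 => residualProj q k -
      Matrix.vecMulVec (unitVec (Matrix.toEuclideanLin (residualProj q k) (q k)))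
        (unitVec (Matrix.toEuclideanLin (residualProj q k) (q k)))

/-- The `k`-th Gram–Schmidt direction of a sequence of vectors; it has norm zero or one. -/
noncomputable def residualDir (q : ℕ → EuclideanSpace ℝ (Fin d)) (k : ℕ) :
    EuclideanSpace ℝ (Fin d) :=
  unitVec (Matrix.toEuclideanLin (residualProj q k) (q k))

variable (q : ℕ → EuclideanSpace ℝ (Fin d))

lemma residualProj_succ (k : ℕ) : residualProj q (k + 1) = residualProj q k -
    Matrix.vecMulVec (residualDir q k) (residualDir q k) := rfl

lemma residualProj_congr {q q' : ℕ → EuclideanSpace ℝ (Fin d)} {k : ℕ}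
    (h : ∀ j < k, q j = q' j) : residualProj q k = residualProj q' k := by
  induction k with
  | zero => rfl
  | succ k ih =>
    rw [residualProj, residualProj, ih fun j hj => h j (by omega), h k (by omega)]

lemma residualProj_transpose (k : ℕ) : (residualProj q k).transpose = residualProj q k := by
  induction k with
  | zero => simp [residualProj]
  | succ k ih => rw [residualProj_succ, Matrix.transpose_sub, ih, Matrix.transpose_vecMulVec]

/-- The second claim drives the induction for the first: since the projection fixes the new
direction, subtracting the rank-one projection onto it leaves a projection. A zero direction changes
nothing. -/
lemma residualProj_mul_self (k : ℕ) : residualProj q k * residualProj q k = residualProj q k ∧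
    Matrix.mulVec (residualProj q k) (residualDir q k) = residualDir q k := by
  have key : ∀ k, residualProj q k * residualProj q k = residualProj q k →
      Matrix.mulVec (residualProj q k) (residualDir q k) = residualDir q k := by
    intro k hk
    have h : Matrix.toEuclideanLin (residualProj q k) (residualDir q k) = residualDir q k := by
      unfold residualDir unitVec
      rw [map_smul, ← toEuclideanLin_mul_apply, hk]
    have h' := congrArg WithLp.ofLp h
    simpa [Matrix.toLpLin_apply] using h'
  induction k with
  | zero => exact ⟨by simp [residualProj], key 0 (by simp [residualProj])⟩
  | succ k ih =>
    refine (fun h => ⟨h, key _ h⟩) ?_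
    obtain ⟨h1, h2⟩ := ih
    have h3 : Matrix.vecMul (residualDir q k) (residualProj q k) = residualDir q k := by
      rw [← Matrix.mulVec_transpose, residualProj_transpose, h2]
    have h4 : Matrix.vecMulVec (residualDir q k) (residualDir q k) *
        Matrix.vecMulVec (residualDir q k) (residualDir q k) =
        Matrix.vecMulVec (residualDir q k) (residualDir q k) := by
      rw [Matrix.vecMulVec_mul_vecMulVec]
      have : (residualDir q k).ofLp ⬝ᵥ (residualDir q k).ofLp = ‖residualDir q k‖ ^ 2 := by
        rw [EuclideanSpace.real_norm_sq_eq]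
        simp [dotProduct, pow_two]
      rw [this]
      rcases norm_unitVec (Matrix.toEuclideanLin (residualProj q k) (q k)) with h | h
      · change ‖residualDir q k‖ = 0 at h
        rw [norm_eq_zero] at h
        simp [h]
      · change ‖residualDir q k‖ = 1 at h
        simp [h]
    rw [residualProj_succ, sub_mul, mul_sub, mul_sub, h1, Matrix.mul_vecMulVec, h2,
      Matrix.vecMulVec_mul, h3, h4]
    abel

lemma residualProj_succ_mul (k : ℕ) :
    residualProj q (k + 1) * residualProj q k = residualProj q (k + 1) := by
  obtain ⟨h1, h2⟩ := residualProj_mul_self q k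
  have h3 : Matrix.vecMul (residualDir q k) (residualProj q k) = residualDir q k := by
    rw [← Matrix.mulVec_transpose, residualProj_transpose, h2]
  rw [residualProj_succ, sub_mul, h1, Matrix.vecMulVec_mul, h3]

lemma residualProj_mul_succ (k : ℕ) :
    residualProj q k * residualProj q (k + 1) = residualProj q (k + 1) := by
  have := congrArg Matrix.transpose (residualProj_succ_mul q k)
  rwa [Matrix.transpose_mul, residualProj_transpose, residualProj_transpose] at this

lemma toEuclideanLin_residualProj_self (k : ℕ) (x : EuclideanSpace ℝ (Fin d)) :
    Matrix.toEuclideanLin (residualProj q k) (Matrix.toEuclideanLin (residualProj q k) x) =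
      Matrix.toEuclideanLin (residualProj q k) x := by
  rw [← toEuclideanLin_mul_apply, (residualProj_mul_self q k).1]

lemma inner_residualProj (k : ℕ) (x y : EuclideanSpace ℝ (Fin d)) :
    inner ℝ (Matrix.toEuclideanLin (residualProj q k) x) y =
      inner ℝ x (Matrix.toEuclideanLin (residualProj q k) y) := by
  rw [inner_toEuclideanLin_left, residualProj_transpose]

lemma toEuclideanLin_residualProj_succ (k : ℕ) (x : EuclideanSpace ℝ (Fin d)) :
    Matrix.toEuclideanLin (residualProj q (k + 1)) x =
      Matrix.toEuclideanLin (residualProj q k) x -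
        inner ℝ (residualDir q k) x • residualDir q k := by
  rw [residualProj_succ, map_sub, LinearMap.sub_apply, toEuclideanLin_vecMulVec]

lemma residualProj_apply_residualDir (k : ℕ) :
    Matrix.toEuclideanLin (residualProj q k) (residualDir q k) = residualDir q k := by
  unfold residualDir unitVec
  rw [map_smul, toEuclideanLin_residualProj_self]

lemma norm_residualDir (k : ℕ) : ‖residualDir q k‖ = 0 ∨ ‖residualDir q k‖ = 1 := norm_unitVec _

lemma residualProj_succ_apply_self (k : ℕ) :
    Matrix.toEuclideanLin (residualProj q (k + 1)) (q k) = 0 := by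
  have h1 : inner ℝ (residualDir q k) (q k) =
      inner ℝ (residualDir q k) (Matrix.toEuclideanLin (residualProj q k) (q k)) := by
    rw [← inner_residualProj, residualProj_apply_residualDir]
  rw [toEuclideanLin_residualProj_succ, h1]
  unfold residualDir unitVec
  set v := Matrix.toEuclideanLin (residualProj q k) (q k)
  rcases eq_or_ne v 0 with h | h
  · simp [h]
  · rw [real_inner_smul_left, real_inner_self_eq_norm_sq, smul_smul]
    have := norm_ne_zero_iff.2 h
    rw [show ‖v‖⁻¹ * ‖v‖ ^ 2 * ‖v‖⁻¹ = 1 by field_simp, one_smul, sub_self]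

lemma residualProj_apply_of_lt {j k : ℕ} (h : j < k) :
    Matrix.toEuclideanLin (residualProj q k) (q j) = 0 := by
  induction k, h using Nat.le_induction with
  | base => exact residualProj_succ_apply_self q j
  | succ k hk ih => rw [← residualProj_succ_mul, toEuclideanLin_mul_apply, ih, map_zero]

lemma inner_residualDir_of_lt {j k : ℕ} (h : j < k) :
    inner ℝ (residualDir q j) (residualDir q k) = 0 := by
  have h1 : Matrix.toEuclideanLin (residualProj q (j + 1)) (residualDir q j) = 0 := by
    rw [toEuclideanLin_residualProj_succ, residualProj_apply_residualDir,
      real_inner_self_eq_norm_sq]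
    rcases norm_residualDir q j with h | h
    · rw [norm_eq_zero] at h; simp [h]
    · simp [h]
  have h2 : Matrix.toEuclideanLin (residualProj q k) (residualDir q j) = 0 := by
    induction k, h using Nat.le_induction with
    | base => exact h1
    | succ k hk ih => rw [← residualProj_succ_mul, toEuclideanLin_mul_apply, ih, map_zero]
  rw [← residualProj_apply_residualDir q k, ← inner_residualProj, h2, inner_zero_left]

lemma inner_residualDir {j k : ℕ} (h : j ≠ k) :
    inner ℝ (residualDir q j) (residualDir q k) = 0 := by
  rcases lt_or_gt_of_ne h with h | h
  · exact inner_residualDir_of_lt q h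
  · rw [real_inner_comm]
    exact inner_residualDir_of_lt q h

/-- The squared length of the projection of `x` to the span of the first `k` vectors of `q`. -/
noncomputable def spanEnergy (k : ℕ) (x : EuclideanSpace ℝ (Fin d)) : ℝ :=
  ‖x‖ ^ 2 - ‖Matrix.toEuclideanLin (residualProj q k) x‖ ^ 2

/-- For frozen `q` and Gaussian `x` this form exposes the energy as a chi-square variable with at
most `k` degrees of freedom. -/
lemma spanEnergy_eq_sum (k : ℕ) (x : EuclideanSpace ℝ (Fin d)) :
    spanEnergy q k x = ∑ j ∈ Finset.range k, (inner ℝ (residualDir q j) x) ^ 2 := by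
  have hsq : ∀ k, ‖Matrix.toEuclideanLin (residualProj q k) x‖ ^ 2 =
      inner ℝ x (Matrix.toEuclideanLin (residualProj q k) x) := by
    intro k
    rw [← real_inner_self_eq_norm_sq, inner_residualProj, toEuclideanLin_residualProj_self]
  unfold spanEnergy
  induction k with
  | zero => simp [residualProj]
  | succ k ih =>
    rw [Finset.sum_range_succ, ← ih, hsq, hsq, toEuclideanLin_residualProj_succ, inner_sub_right,
      real_inner_smul_right, real_inner_comm x]
    ring

lemma spanEnergy_zero (x : EuclideanSpace ℝ (Fin d)) : spanEnergy q 0 x = 0 := by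
  simp [spanEnergy_eq_sum]

lemma spanEnergy_nonneg (k : ℕ) (x : EuclideanSpace ℝ (Fin d)) : 0 ≤ spanEnergy q k x := by
  rw [spanEnergy_eq_sum]
  positivity

lemma spanEnergy_congr {q q' : ℕ → EuclideanSpace ℝ (Fin d)} {k : ℕ}
    (h : ∀ j < k, q j = q' j) (x : EuclideanSpace ℝ (Fin d)) :
    spanEnergy q k x = spanEnergy q' k x := by
  rw [spanEnergy, spanEnergy, residualProj_congr h]

/-- Since `q j` lies in the span, it only pairs with the component of `x` there, and Cauchy–Schwarz
applies. Used with the output as `q j`, this reduces the theorem to a bound on the energy. -/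
lemma inner_unitVec_sq_le_spanEnergy {j k : ℕ} (h : j < k) (x : EuclideanSpace ℝ (Fin d)) :
    (inner ℝ (unitVec (q j)) x) ^ 2 ≤ spanEnergy q k x := by
  set Qx := Matrix.toEuclideanLin (residualProj q k) x with hQx
  have h1 : inner ℝ (unitVec (q j)) Qx = 0 := by
    rw [hQx, ← inner_residualProj, unitVec, map_smul, residualProj_apply_of_lt q h, smul_zero,
      inner_zero_left]
  have h2 : inner ℝ (unitVec (q j)) x = inner ℝ (unitVec (q j)) (x - Qx) := by
    rw [inner_sub_right, h1, sub_zero]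
  have h3 : spanEnergy q k x = ‖x - Qx‖ ^ 2 := by
    have : inner ℝ x Qx = ‖Qx‖ ^ 2 := by
      rw [← real_inner_self_eq_norm_sq, hQx, inner_residualProj, toEuclideanLin_residualProj_self]
    rw [@norm_sub_sq_real, this, spanEnergy]
    ring
  have h4 : ‖unitVec (q j)‖ ≤ 1 := by
    rcases norm_unitVec (q j) with h | h <;> simp [h]
  rw [h2, h3, ← sq_abs]
  refine pow_le_pow_left₀ (abs_nonneg _) ((abs_real_inner_le_norm _ _).trans ?_) 2
  exact mul_le_of_le_one_left (norm_nonneg _) h4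

lemma measurable_residualProj {Ω : Type*} [MeasurableSpace Ω]
    {q : ℕ → Ω → EuclideanSpace ℝ (Fin d)} (k : ℕ) (hq : ∀ j < k, Measurable (q j)) (a b : Fin d) :
    Measurable fun ω => residualProj (fun j => q j ω) k a b := by
  induction k generalizing a b with
  | zero => exact measurable_const
  | succ k ih =>
    have ih' := fun a b => ih (fun j hj => hq j (by omega)) a b
    have hqk := hq k (by omega)
    have hdir : Measurable fun ω => residualDir (fun j => q j ω) k := by
      unfold residualDir
      refine measurable_unitVec.comp ?_
      simp only [Matrix.toLpLin_apply]
      refine (WithLp.measurable_toLp 2 _).comp (measurable_pi_iff.2 fun i => ?_)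
      simp only [Matrix.mulVec, dotProduct]
      have : ∀ c, Measurable fun ω => (q k ω).ofLp c := fun c => by fun_prop
      exact Finset.measurable_sum _ fun c _ => (ih' i c).mul (this c)
    have hc : ∀ c, Measurable fun ω => (residualDir (fun j => q j ω) k).ofLp c := fun c =>
      (measurable_pi_apply c).comp ((WithLp.measurable_ofLp 2 _).comp hdir)
    simp only [residualProj_succ, Matrix.sub_apply, Matrix.vecMulVec_apply]
    exact (ih' a b).sub ((hc a).mul (hc b))

lemma measurable_spanEnergy {Ω : Type*} [MeasurableSpace Ω]
    {q : ℕ → Ω → EuclideanSpace ℝ (Fin d)} (k : ℕ) (hq : ∀ j < k, Measurable (q j))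
    {x : Ω → EuclideanSpace ℝ (Fin d)} (hx : Measurable x) :
    Measurable fun ω => spanEnergy (fun j => q j ω) k (x ω) := by
  unfold spanEnergy
  refine (hx.norm.pow_const 2).sub (Measurable.pow_const (Measurable.norm ?_) 2)
  simp only [Matrix.toLpLin_apply]
  refine (WithLp.measurable_toLp 2 _).comp (measurable_pi_iff.2 fun i => ?_)
  simp only [Matrix.mulVec, dotProduct]
  have : ∀ c, Measurable fun ω => (x ω).ofLp c := fun c => by fun_prop
  exact Finset.measurable_sum _ fun c _ => (measurable_residualProj k hq i c).mul (this c)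

end GramSchmidt

/-! ### Compression of a matrix to the unqueried directions. -/

section Compress

variable {d : ℕ}

/-- A vector of `ℝ^(d × d)` read as a matrix. -/
def toMat (G : EuclideanSpace ℝ (Fin d × Fin d)) : Matrix (Fin d) (Fin d) ℝ :=
  Matrix.of fun i j => G (i, j)

lemma toMat_injective : Function.Injective (toMat (d := d)) := by
  intro G G' h
  ext ⟨i, j⟩
  exact congrFun (congrFun h i) j

@[simp] lemma toMat_add (G H : EuclideanSpace ℝ (Fin d × Fin d)) :
    toMat (G + H) = toMat G + toMat H := rfl

@[simp] lemma toMat_sub (G H : EuclideanSpace ℝ (Fin d × Fin d)) :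
    toMat (G - H) = toMat G - toMat H := rfl

@[simp] lemma toMat_smul (c : ℝ) (G : EuclideanSpace ℝ (Fin d × Fin d)) :
    toMat (c • G) = c • toMat G := rfl

lemma inner_eq_trace (G H : EuclideanSpace ℝ (Fin d × Fin d)) :
    inner ℝ G H = Matrix.trace ((toMat G).transpose * toMat H) := by
  simp only [PiLp.inner_apply, Matrix.trace, Matrix.diag, Matrix.mul_apply, toMat,
    Matrix.transpose_apply, Matrix.of_apply, Fintype.sum_prod_type]
  rw [Finset.sum_comm]
  simp [mul_comm]

/-- The map `G ↦ Q G Q` on matrices. -/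
noncomputable def compress (Q : Matrix (Fin d) (Fin d) ℝ) :
    EuclideanSpace ℝ (Fin d × Fin d) →L[ℝ] EuclideanSpace ℝ (Fin d × Fin d) :=
  LinearMap.toContinuousLinearMap
    { toFun := fun G => WithLp.toLp 2 fun p => (Q * toMat G * Q) p.1 p.2
      map_add' := fun G H => by
        ext p
        simp [mul_add, add_mul]
      map_smul' := fun c G => by
        ext p
        simp }

@[simp] lemma toMat_compress (Q : Matrix (Fin d) (Fin d) ℝ)
    (G : EuclideanSpace ℝ (Fin d × Fin d)) : toMat (compress Q G) = Q * toMat G * Q := rfl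

/-- The hypotheses say that `Q` is subordinate to `Q'`, as a later residual projection is to an
earlier one; the later compression then absorbs the earlier. -/
lemma compress_comp (Q Q' : Matrix (Fin d) (Fin d) ℝ) (h : Q * Q' = Q) (h' : Q' * Q = Q)
    (G : EuclideanSpace ℝ (Fin d × Fin d)) : compress Q (compress Q' G) = compress Q G := by
  apply toMat_injective
  simp only [toMat_compress]
  calc Q * (Q' * toMat G * Q') * Q = (Q * Q') * toMat G * (Q' * Q) := by noncomm_ring
    _ = _ := by rw [h, h']

lemma compress_comp' (Q Q' : Matrix (Fin d) (Fin d) ℝ) (h : Q * Q' = Q) (h' : Q' * Q = Q)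
    (G : EuclideanSpace ℝ (Fin d × Fin d)) : compress Q' (compress Q G) = compress Q G := by
  apply toMat_injective
  simp only [toMat_compress]
  calc Q' * (Q * toMat G * Q) * Q' = (Q' * Q) * toMat G * (Q * Q') := by noncomm_ring
    _ = _ := by rw [h, h']

/-- Together with idempotence this makes `compress Q` an orthogonal projection of the matrix space,
the setting of `map_resample_stdGaussian`. -/
lemma inner_compress {Q : Matrix (Fin d) (Fin d) ℝ} (hQ : Q.transpose = Q)
    (G H : EuclideanSpace ℝ (Fin d × Fin d)) :
    inner ℝ (compress Q G) H = inner ℝ G (compress Q H) := by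
  rw [inner_eq_trace, inner_eq_trace, toMat_compress, toMat_compress, Matrix.transpose_mul,
    Matrix.transpose_mul, hQ, Matrix.mul_assoc, Matrix.trace_mul_comm]
  congr 1
  simp only [Matrix.mul_assoc]

lemma measurable_compress {Ω : Type*} [MeasurableSpace Ω] {Q : Ω → Matrix (Fin d) (Fin d) ℝ}
    (hQ : ∀ i j, Measurable fun ω => Q ω i j) {G : Ω → EuclideanSpace ℝ (Fin d × Fin d)}
    (hG : Measurable G) : Measurable fun ω => compress (Q ω) (G ω) := by
  have : (fun ω => compress (Q ω) (G ω)) = fun ω => WithLp.toLp 2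
      (fun p : Fin d × Fin d => (Q ω * toMat (G ω) * Q ω) p.1 p.2) := rfl
  rw [this]
  refine (WithLp.measurable_toLp 2 _).comp (measurable_pi_iff.2 fun p => ?_)
  simp only [Matrix.mul_apply, toMat, Matrix.of_apply]
  have hG' : ∀ c, Measurable fun ω => (G ω).ofLp c := fun c => by fun_prop
  exact Finset.measurable_sum _ fun a _ => (Finset.measurable_sum _ fun b _ =>
    (hQ _ _).mul (hG' _)).mul (hQ _ _)

/-- The rank-one matrix `x xᵀ`. -/
noncomputable def outerSq (x : EuclideanSpace ℝ (Fin d)) : EuclideanSpace ℝ (Fin d × Fin d) :=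
  WithLp.toLp 2 fun p => x p.1 * x p.2

lemma toMat_outerSq (x : EuclideanSpace ℝ (Fin d)) :
    toMat (outerSq x) = Matrix.vecMulVec x x := rfl

lemma norm_outerSq_sq (x : EuclideanSpace ℝ (Fin d)) : ‖outerSq x‖ ^ 2 = (‖x‖ ^ 2) ^ 2 := by
  rw [EuclideanSpace.real_norm_sq_eq, EuclideanSpace.real_norm_sq_eq, Fintype.sum_prod_type,
    pow_two (∑ i, _), Finset.sum_mul_sum]
  simp [outerSq, mul_pow]

lemma compress_outerSq {Q : Matrix (Fin d) (Fin d) ℝ} (hQ : Q.transpose = Q)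
    (x : EuclideanSpace ℝ (Fin d)) :
    compress Q (outerSq x) = outerSq (Matrix.toEuclideanLin Q x) := by
  apply toMat_injective
  rw [toMat_compress, toMat_outerSq, toMat_outerSq, Matrix.mul_vecMulVec, Matrix.vecMulVec_mul,
    ← Matrix.mulVec_transpose, hQ]
  rfl

lemma measurable_outerSq : Measurable (outerSq (d := d)) := by
  unfold outerSq
  fun_prop

end Compress

/-! ### Resampling and likelihood ratios under adaptive queries. -/

section Adaptive

variable {d : ℕ}

/-- A sequence of vector-valued functions of a matrix `G` is nonanticipating up to time `T` if the
first `k + 1` vectors, `k ≤ T`, only depend on the part of `G` revealed by multiplying `G` and `Gᵀ`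
with the first `k` vectors. -/
def Nonanticipating (q : ℕ → EuclideanSpace ℝ (Fin d × Fin d) → EuclideanSpace ℝ (Fin d))
    (T : ℕ) : Prop :=
  ∀ k ≤ T, ∀ G G', G - compress (residualProj (fun j => q j G) k) G =
    G' - compress (residualProj (fun j => q j G) k) G' → ∀ j ≤ k, q j G = q j G'

/-- The matrix `G` with its unrevealed part replaced by that of `Y`. -/
noncomputable def resample
    (q : ℕ → EuclideanSpace ℝ (Fin d × Fin d) → EuclideanSpace ℝ (Fin d)) (k : ℕ)
    (G Y : EuclideanSpace ℝ (Fin d × Fin d)) : EuclideanSpace ℝ (Fin d × Fin d) :=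
  G - compress (residualProj (fun j => q j G) k) G + compress (residualProj (fun j => q j G) k) Y

variable {q : ℕ → EuclideanSpace ℝ (Fin d × Fin d) → EuclideanSpace ℝ (Fin d)} {T : ℕ}

lemma compress_residualProj_self (p : ℕ → EuclideanSpace ℝ (Fin d)) (k : ℕ)
    (G : EuclideanSpace ℝ (Fin d × Fin d)) :
    compress (residualProj p k) (compress (residualProj p k) G) = compress (residualProj p k) G :=
  compress_comp _ _ (residualProj_mul_self p k).1 (residualProj_mul_self p k).1 G

lemma resample_sub_compress (k : ℕ) (G Y : EuclideanSpace ℝ (Fin d × Fin d)) :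
    resample q k G Y - compress (residualProj (fun j => q j G) k) (resample q k G Y) =
      G - compress (residualProj (fun j => q j G) k) G := by
  unfold resample
  rw [map_add, map_sub, compress_residualProj_self, compress_residualProj_self]
  abel

lemma Nonanticipating.apply_resample (hq : Nonanticipating q T) {k : ℕ} (hk : k ≤ T)
    (G Y : EuclideanSpace ℝ (Fin d × Fin d)) {j : ℕ} (hj : j ≤ k) :
    q j (resample q k G Y) = q j G :=
  (hq k hk G _ (resample_sub_compress k G Y).symm j hj).symm

lemma measurable_resample (hmeas : ∀ j, Measurable (q j)) (k : ℕ) :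
    Measurable fun p : EuclideanSpace ℝ (Fin d × Fin d) × EuclideanSpace ℝ (Fin d × Fin d) =>
      resample q k p.1 p.2 := by
  unfold resample
  have hQ : ∀ a b, Measurable fun p : EuclideanSpace ℝ (Fin d × Fin d) ×
      EuclideanSpace ℝ (Fin d × Fin d) => residualProj (fun j => q j p.1) k a b := fun a b =>
    measurable_residualProj (q := fun j (p : EuclideanSpace ℝ (Fin d × Fin d) ×
      EuclideanSpace ℝ (Fin d × Fin d)) => q j p.1) k (fun j _ => (hmeas j).comp measurable_fst) a b
  exact (measurable_fst.sub (measurable_compress hQ measurable_fst)).add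
    (measurable_compress hQ measurable_snd)

/-- Resampling the unrevealed part of a standard Gaussian matrix does not change its law, even if
the revealed part was chosen adaptively. -/
lemma Nonanticipating.lintegral_resample (hq : Nonanticipating q T)
    (hmeas : ∀ j, Measurable (q j)) {k : ℕ} (hk : k ≤ T)
    {f : EuclideanSpace ℝ (Fin d × Fin d) → ℝ≥0∞} (hf : Measurable f) :
    ∫⁻ G, ∫⁻ Y, f (resample q k G Y) ∂(stdGaussian (EuclideanSpace ℝ (Fin d × Fin d)))
        ∂(stdGaussian (EuclideanSpace ℝ (Fin d × Fin d))) =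
      ∫⁻ G, f G ∂(stdGaussian (EuclideanSpace ℝ (Fin d × Fin d))) := by
  induction k generalizing f with
  | zero =>
    have h : ∀ G Y, resample q 0 G Y = Y := by
      intro G Y
      apply toMat_injective
      simp [resample, residualProj]
    simp [h]
  | succ k ih =>
    have hk' : k ≤ T := by omega
    have hres := measurable_resample hmeas (k + 1)
    have hm : Measurable fun G => ∫⁻ Y, f (resample q (k + 1) G Y)
        ∂(stdGaussian (EuclideanSpace ℝ (Fin d × Fin d))) :=
      Measurable.lintegral_prod_right' (f := fun p => f (resample q (k + 1) p.1 p.2))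
        (hf.comp hres)
    -- A resampling at level `k` is inserted on both sides. With `G` frozen, only `Y` is random and
    -- both residual projections are fixed, so the adaptive statement reduces to resampling along a
    -- fixed projection.
    rw [← ih hk' hm, ← ih hk' hf]
    refine lintegral_congr fun G => ?_
    set Q := residualProj (fun j => q j G) k with hQ
    set Q' := residualProj (fun j => q j G) (k + 1) with hQ'
    have h1 : Q' * Q = Q' := residualProj_succ_mul _ k
    have h2 : Q * Q' = Q' := residualProj_mul_succ _ k
    have hQ's : Q'.transpose = Q' := residualProj_transpose _ _
    have h3 : ∀ Y Z, resample q (k + 1) (resample q k G Y) Z =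
        G - compress Q G + compress Q (Y - compress Q' Y + compress Q' Z) := by
      intro Y Z
      -- The projection after `k + 1` queries involves `q 0, …, q k`, all determined by what is
      -- revealed after `k` of them.
      have h4 : residualProj (fun j => q j (resample q k G Y)) (k + 1) = Q' :=
        residualProj_congr fun j hj => hq.apply_resample hk' G Y (by omega)
      rw [resample, h4, resample, ← hQ, map_add, map_sub, compress_comp Q' Q h1 h2,
        compress_comp Q' Q h1 h2, map_add, map_sub, compress_comp' Q' Q h1 h2,
        compress_comp' Q' Q h1 h2]
      abel
    simp_rw [h3]
    refine lintegral_resample_stdGaussian (compress Q') (inner_compress hQ's)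
      (compress_residualProj_self _ _) (f := fun Y => f (G - compress Q G + compress Q Y)) ?_
    fun_prop

/-- The logarithm of the likelihood ratio of a shift by `m`, as seen from the revealed part of
the matrix. -/
noncomputable def revealedLogRatio
    (q : ℕ → EuclideanSpace ℝ (Fin d × Fin d) → EuclideanSpace ℝ (Fin d)) (k : ℕ)
    (m G : EuclideanSpace ℝ (Fin d × Fin d)) : ℝ :=
  inner ℝ (G - compress (residualProj (fun j => q j G) k) G) m -
    (‖m‖ ^ 2 - ‖compress (residualProj (fun j => q j G) k) m‖ ^ 2) / 2

lemma measurable_revealedLogRatio (hmeas : ∀ j, Measurable (q j)) (k : ℕ)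
    (m : EuclideanSpace ℝ (Fin d × Fin d)) : Measurable fun G => revealedLogRatio q k m G := by
  unfold revealedLogRatio
  have hQ := fun i j => measurable_residualProj k (fun j _ => hmeas j) i j
  have h1 : Measurable fun G => compress (residualProj (fun j => q j G) k) G :=
    measurable_compress hQ measurable_id
  have h2 : Measurable fun G => compress (residualProj (fun j => q j G) k) m :=
    measurable_compress hQ measurable_const
  fun_prop

/-- The law of the revealed part of a shifted Gaussian matrix has an explicit density with respect
to that of the centred one. -/
lemma Nonanticipating.lintegral_add (hq : Nonanticipating q T)
    (hmeas : ∀ j, Measurable (q j)) {k : ℕ} (hk : k ≤ T) (m : EuclideanSpace ℝ (Fin d × Fin d))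
    {f : EuclideanSpace ℝ (Fin d × Fin d) → ℝ≥0∞} (hf : Measurable f)
    (hfq : ∀ G Y, f (resample q k G Y) = f G) :
    ∫⁻ G, f (G + m) ∂(stdGaussian (EuclideanSpace ℝ (Fin d × Fin d))) =
      ∫⁻ G, ENNReal.ofReal (Real.exp (revealedLogRatio q k m G)) * f G
        ∂(stdGaussian (EuclideanSpace ℝ (Fin d × Fin d))) := by
  rw [lintegral_add_stdGaussian m hf, ← hq.lintegral_resample hmeas hk (by fun_prop)]
  refine lintegral_congr fun G => ?_
  set Q := residualProj (fun j => q j G) k with hQ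
  have hQs : Q.transpose = Q := residualProj_transpose _ _
  -- Since `f` does not see the redrawn part, `Y` enters only through `exp ⟨Y, Q m Q⟩`, whose
  -- Gaussian mean `exp (‖Q m Q‖² / 2)` corrects the normalization.
  have h1 : ∀ Y, ENNReal.ofReal (Real.exp (inner ℝ (resample q k G Y) m - ‖m‖ ^ 2 / 2)) *
      f (resample q k G Y) =
      ENNReal.ofReal (Real.exp (inner ℝ (G - compress Q G) m - ‖m‖ ^ 2 / 2)) * f G *
        ENNReal.ofReal (Real.exp (inner ℝ Y (compress Q m))) := by
    intro Y
    rw [hfq, mul_right_comm, ← ENNReal.ofReal_mul (Real.exp_nonneg _), ← Real.exp_add, resample,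
      ← hQ, inner_add_left, inner_compress hQs Y]
    ring_nf
  simp_rw [h1]
  rw [lintegral_const_mul _ (by fun_prop), lintegral_exp_inner_stdGaussian, mul_right_comm,
    ← ENNReal.ofReal_mul (Real.exp_nonneg _), ← Real.exp_add, revealedLogRatio, ← hQ]
  ring_nf

lemma Nonanticipating.lintegral_exp_revealedLogRatio (hq : Nonanticipating q T)
    (hmeas : ∀ j, Measurable (q j)) {k : ℕ} (hk : k ≤ T)
    (m : EuclideanSpace ℝ (Fin d × Fin d)) :
    ∫⁻ G, ENNReal.ofReal (Real.exp (revealedLogRatio q k m G))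
        ∂(stdGaussian (EuclideanSpace ℝ (Fin d × Fin d))) = 1 := by
  have := hq.lintegral_add hmeas hk m (f := fun _ => 1) measurable_const (fun _ _ => rfl)
  simpa using this.symm

/-- A power of the likelihood ratio is the likelihood ratio of the scaled shift, which has mean one,
times a factor that low energy keeps bounded pointwise. -/
lemma mul_revealedLogRatio (p : ℝ) (k : ℕ) (m G : EuclideanSpace ℝ (Fin d × Fin d)) :
    p * revealedLogRatio q k m G = revealedLogRatio q k (p • m) G +
      p * (p - 1) / 2 *
        (‖m‖ ^ 2 - ‖compress (residualProj (fun j => q j G) k) m‖ ^ 2) := by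
  unfold revealedLogRatio
  rw [map_smul, norm_smul, norm_smul, mul_pow, mul_pow, real_inner_smul_right, Real.norm_eq_abs,
    sq_abs]
  ring

/-- A rank-one signal reveals little information along directions which correlate little with
it. -/
lemma norm_sq_sub_compress_outerSq_le (p : ℕ → EuclideanSpace ℝ (Fin d)) (k : ℕ) (c : ℝ)
    (x : EuclideanSpace ℝ (Fin d)) :
    ‖c • outerSq x‖ ^ 2 - ‖compress (residualProj p k) (c • outerSq x)‖ ^ 2 ≤
      2 * c ^ 2 * ‖x‖ ^ 2 * spanEnergy p k x := by
  rw [map_smul, norm_smul, norm_smul, mul_pow, mul_pow, compress_outerSq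
    (residualProj_transpose _ _), norm_outerSq_sq, norm_outerSq_sq, Real.norm_eq_abs, sq_abs]
  have h := spanEnergy_nonneg p k x
  unfold spanEnergy at h ⊢
  set a := ‖x‖ ^ 2
  set b := ‖Matrix.toEuclideanLin (residualProj p k) x‖ ^ 2
  -- This rests on `a² - b² = 2 a (a - b) - (a - b)²`.
  nlinarith [mul_nonneg (sq_nonneg c) (sq_nonneg (a - b))]

end Adaptive

/-! ### The change of measure for one round. -/

section SpikedModel

/-- Vectors of `ℝ^d`. -/
abbrev Vec (d : ℕ) := EuclideanSpace ℝ (Fin d)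

/-- Square matrices, as vectors of `ℝ^(d × d)`. -/
abbrev SqMat (d : ℕ) := EuclideanSpace ℝ (Fin d × Fin d)

variable {d : ℕ} {q : ℕ → Vec d → SqMat d → Vec d} {T : ℕ}

/-- The event that the energy of `x` in the span of the queries jumps from at most `B` to more than
`B'` in round `k`, for a signal of squared norm at most `A`. -/
def jumpEvent (q : ℕ → Vec d → SqMat d → Vec d) (k : ℕ) (A B B' : ℝ) :
    Set (Vec d × Vec d × SqMat d) :=
  {ω | ‖ω.1‖ ^ 2 ≤ A ∧ spanEnergy (fun j => q j ω.2.1 ω.2.2) k ω.1 ≤ B ∧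
    B' < spanEnergy (fun j => q j ω.2.1 ω.2.2) (k + 1) ω.1}

lemma measurable_spanEnergy_query (hmeas : ∀ j, Measurable fun p : Vec d × SqMat d => q j p.1 p.2)
    (k : ℕ) : Measurable fun ω : Vec d × Vec d × SqMat d =>
      spanEnergy (fun j => q j ω.2.1 ω.2.2) k ω.1 :=
  measurable_spanEnergy (q := fun j (ω : Vec d × Vec d × SqMat d) => q j ω.2.1 ω.2.2) k
    (fun j _ => (hmeas j).comp measurable_snd) measurable_fst

lemma measurableSet_jumpEvent (hmeas : ∀ j, Measurable fun p : Vec d × SqMat d => q j p.1 p.2)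
    (k : ℕ) (A B B' : ℝ) : MeasurableSet (jumpEvent q k A B B') := by
  have h := measurable_spanEnergy_query hmeas
  have hx : Measurable fun ω : Vec d × Vec d × SqMat d => ‖ω.1‖ ^ 2 := by fun_prop
  exact (measurableSet_le hx measurable_const).inter
    ((measurableSet_le (h k) measurable_const).inter (measurableSet_lt measurable_const (h (k + 1))))

/-- A vector of low energy rarely has high energy in a span of dimension `k` chosen independently
of it. -/
lemma lintegral_spanEnergy_gt_le (hmeas : ∀ j, Measurable fun p : Vec d × SqMat d => q j p.1 p.2)
    (k : ℕ) {s : ℝ} (hs0 : 0 ≤ s) (hs : s < 1) (B : ℝ) :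
    ∫⁻ x, ∫⁻ z, ∫⁻ G, {ω : Vec d × Vec d × SqMat d |
        B < spanEnergy (fun j => q j ω.2.1 ω.2.2) k ω.1}.indicator 1 (x, z, G)
      ∂(stdGaussian (SqMat d)) ∂(stdGaussian (Vec d)) ∂(stdGaussian (Vec d)) ≤
      ENNReal.ofReal ((Real.sqrt (1 - s))⁻¹ ^ k * Real.exp (-(s * B / 2))) := by
  have hS : MeasurableSet {ω : Vec d × Vec d × SqMat d |
      B < spanEnergy (fun j => q j ω.2.1 ω.2.2) k ω.1} :=
    measurableSet_lt measurable_const (measurable_spanEnergy_query hmeas k)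
  set S := {ω : Vec d × Vec d × SqMat d | B < spanEnergy (fun j => q j ω.2.1 ω.2.2) k ω.1}
  have hf : Measurable (S.indicator (1 : Vec d × Vec d × SqMat d → ℝ≥0∞)) :=
    measurable_one.indicator hS
  have h1 : ∀ x, ∫⁻ z, ∫⁻ G, S.indicator (1 : Vec d × Vec d × SqMat d → ℝ≥0∞) (x, z, G)
      ∂(stdGaussian (SqMat d)) ∂(stdGaussian (Vec d)) = ∫⁻ p, S.indicator (1 : Vec d × Vec d × SqMat d → ℝ≥0∞) (x, p)
        ∂((stdGaussian (Vec d)).prod (stdGaussian (SqMat d))) := by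
    intro x
    rw [lintegral_prod _ (by fun_prop)]
  simp_rw [h1]
  -- Here the queries do not depend on `x`, so they can be frozen first and `x` integrated against a
  -- fixed orthogonal family.
  rw [lintegral_lintegral_swap (f := fun x p =>
    S.indicator (1 : Vec d × Vec d × SqMat d → ℝ≥0∞) (x, p)) hf.aemeasurable]
  calc _ ≤ ∫⁻ _, ENNReal.ofReal ((Real.sqrt (1 - s))⁻¹ ^ k * Real.exp (-(s * B / 2)))
        ∂((stdGaussian (Vec d)).prod (stdGaussian (SqMat d))) := by
        refine lintegral_mono fun p => ?_
        have h2 := stdGaussian_sum_inner_sq_gt_le (E := Vec d) hs0 hs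
          (residualDir fun j => q j p.1 p.2) (norm_residualDir _)
          (fun i j => inner_residualDir _) (Finset.range k) B
        rw [Finset.card_range] at h2
        simp_rw [← spanEnergy_eq_sum] at h2
        refine le_trans (le_of_eq ?_) h2
        rw [← lintegral_indicator_one]
        · rfl
        · exact measurable_prodMk_right hS
    _ = _ := by simp

/-- A likelihood ratio is either at most `exp θ` or is dominated by its power `1 + η` times `exp (-η
θ)`. -/
lemma exp_le_truncation {η θ l r : ℝ} (hη : 0 ≤ η) (hl : (1 + η) * l ≤ r) :
    ENNReal.ofReal (Real.exp l) ≤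
      ENNReal.ofReal (Real.exp θ) + ENNReal.ofReal (Real.exp (r - η * θ)) := by
  rcases le_total l θ with h | h
  · exact (ENNReal.ofReal_le_ofReal (Real.exp_le_exp.2 h)).trans le_self_add
  · refine (ENNReal.ofReal_le_ofReal (Real.exp_le_exp.2 ?_)).trans le_add_self
    nlinarith

/-- In each round, the energy of the signal in the span of the queries is unlikely to jump. -/
lemma lintegral_jumpEvent_le (hq : ∀ b, Nonanticipating (fun j G => q j b G) T)
    (hmeas : ∀ j, Measurable fun p : Vec d × SqMat d => q j p.1 p.2)
    {k : ℕ} (hk : k ≤ T) {A B B' c t s η θ : ℝ} (hs0 : 0 ≤ s) (hs : s < 1) (hη : 0 ≤ η) :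
    ∫⁻ x, ∫⁻ z, ∫⁻ G, (jumpEvent q k A B B').indicator 1 (x, z + t • x, G + c • outerSq x)
      ∂(stdGaussian (SqMat d)) ∂(stdGaussian (Vec d)) ∂(stdGaussian (Vec d)) ≤
      ENNReal.ofReal (Real.exp θ) *
        ENNReal.ofReal ((Real.sqrt (1 - s))⁻¹ ^ (k + 1) * Real.exp (-(s * B' / 2))) +
      ENNReal.ofReal (Real.exp ((1 + η) * η / 2 * (t ^ 2 * A + 2 * c ^ 2 * A * B) - η * θ)) := by
  set f : Vec d × Vec d × SqMat d → ℝ≥0∞ := (jumpEvent q k A B B').indicator 1 with hfdef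
  have hf : Measurable f := measurable_one.indicator (measurableSet_jumpEvent hmeas k A B B')
  set S := {ω : Vec d × Vec d × SqMat d | B' < spanEnergy (fun j => q j ω.2.1 ω.2.2) (k + 1) ω.1}
  have hS : MeasurableSet S :=
    measurableSet_lt measurable_const (measurable_spanEnergy_query hmeas (k + 1))
  have hSm : Measurable (S.indicator (1 : Vec d × Vec d × SqMat d → ℝ≥0∞)) :=
    measurable_one.indicator hS
  set κ := (1 + η) * η / 2 * (t ^ 2 * A + 2 * c ^ 2 * A * B) - η * θ with hκ
  have hmeas' : ∀ z j, Measurable fun G => q j z G := fun z j =>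
    (hmeas j).comp measurable_prodMk_left
  -- The event involves `k + 1` queries but only the matrix information revealed by `k` of them.
  -- Hence the likelihood ratio is controlled by the energy before the jump.
  have hres : ∀ x z G Y, f (x, z, resample (fun j G => q j z G) k G Y) = f (x, z, G) := by
    intro x z G Y
    have h := fun j (hj : j ≤ k) => (hq z).apply_resample hk G Y hj
    have h1 : spanEnergy (fun j => q j z (resample (fun j G => q j z G) k G Y)) k x =
        spanEnergy (fun j => q j z G) k x := spanEnergy_congr (fun j hj => h j (by omega)) x
    have h2 : spanEnergy (fun j => q j z (resample (fun j G => q j z G) k G Y)) (k + 1) x =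
        spanEnergy (fun j => q j z G) (k + 1) x := spanEnergy_congr (fun j hj => h j (by omega)) x
    simp only [hfdef, Set.indicator, jumpEvent, Set.mem_ofPred_eq, h1, h2, Pi.one_apply]
  have hxz : ∀ x, ∫⁻ z, ∫⁻ G, f (x, z + t • x, G + c • outerSq x) ∂(stdGaussian (SqMat d))
      ∂(stdGaussian (Vec d)) ≤ ENNReal.ofReal (Real.exp θ) *
        (∫⁻ z, ∫⁻ G, S.indicator 1 (x, z, G) ∂(stdGaussian (SqMat d)) ∂(stdGaussian (Vec d))) +
        ENNReal.ofReal (Real.exp κ) := by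
    intro x
    set m := c • outerSq x with hm
    have hg : Measurable fun b => ∫⁻ G, f (x, b, G + m) ∂(stdGaussian (SqMat d)) :=
      Measurable.lintegral_prod_right' (f := fun p : Vec d × SqMat d => f (x, p.1, p.2 + m))
        (by fun_prop)
    rw [lintegral_add_stdGaussian (t • x) hg]
    have hz : ∀ z, ENNReal.ofReal (Real.exp (inner ℝ z (t • x) - ‖t • x‖ ^ 2 / 2)) *
        ∫⁻ G, f (x, z, G + m) ∂(stdGaussian (SqMat d)) ≤
        ENNReal.ofReal (Real.exp θ) * ∫⁻ G, S.indicator 1 (x, z, G) ∂(stdGaussian (SqMat d)) +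
        ENNReal.ofReal (Real.exp κ) * ENNReal.ofReal (Real.exp
          (inner ℝ z ((1 + η) • (t • x)) - ‖(1 + η) • (t • x)‖ ^ 2 / 2)) := by
      intro z
      rw [(hq z).lintegral_add (hmeas' z) hk m (f := fun G => f (x, z, G)) (by fun_prop)
        (hres x z)]
      have hrm := measurable_revealedLogRatio (hmeas' z) k m
      have hrm' := measurable_revealedLogRatio (hmeas' z) k ((1 + η) • m)
      rw [← lintegral_const_mul _ (by fun_prop), ← lintegral_const_mul _ (by fun_prop)]
      set lb := inner ℝ z ((1 + η) • (t • x)) - ‖(1 + η) • (t • x)‖ ^ 2 / 2 with hlb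
      calc _ ≤ ∫⁻ G, (ENNReal.ofReal (Real.exp θ) * S.indicator 1 (x, z, G) +
            ENNReal.ofReal (Real.exp κ) * ENNReal.ofReal (Real.exp lb) *
            ENNReal.ofReal (Real.exp (revealedLogRatio (fun j G => q j z G) k ((1 + η) • m) G)))
            ∂(stdGaussian (SqMat d)) := by
            refine lintegral_mono fun G => ?_
            by_cases hG : (x, z, G) ∈ jumpEvent q k A B B'
            · have hGS : (x, z, G) ∈ S := hG.2.2
              simp only [hfdef, Set.indicator_of_mem hG, Set.indicator_of_mem hGS, Pi.one_apply,
                mul_one]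
              rw [← ENNReal.ofReal_mul (Real.exp_nonneg _), ← Real.exp_add,
                ← ENNReal.ofReal_mul (Real.exp_nonneg _), ← Real.exp_add,
                ← ENNReal.ofReal_mul (Real.exp_nonneg _), ← Real.exp_add]
              obtain ⟨hA, hB, -⟩ := hG
              simp only at hA hB
              refine (exp_le_truncation (θ := θ) hη (r := κ + lb +
                revealedLogRatio (fun j G => q j z G) k ((1 + η) • m) G + η * θ) ?_).trans
                  (le_of_eq ?_)
              · have hn : ∀ (a : ℝ) (v : Vec d), ‖a • v‖ ^ 2 = a ^ 2 * ‖v‖ ^ 2 := fun a v => by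
                  rw [norm_smul, mul_pow, Real.norm_eq_abs, sq_abs]
                rw [mul_add, mul_revealedLogRatio, hlb, hκ, hn (1 + η), hn t,
                  real_inner_smul_right z _ (1 + η)]
                -- The jump event bounds both the norm of `x` and its energy before the round, which
                -- makes the excess in the `1 + η` power deterministic.
                have h1 : ‖m‖ ^ 2 - ‖compress (residualProj (fun j => q j z G) k) m‖ ^ 2 ≤
                    2 * c ^ 2 * A * B := by
                  refine (norm_sq_sub_compress_outerSq_le (fun j => q j z G) k c x).trans ?_
                  have := spanEnergy_nonneg (fun j => q j z G) k x
                  have hA0 : 0 ≤ A := (sq_nonneg _).trans hA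
                  gcongr
                have h2 : t ^ 2 * ‖x‖ ^ 2 ≤ t ^ 2 * A := by gcongr
                have h3 : 0 ≤ (1 + η) * η / 2 := by positivity
                have h4 := mul_le_mul_of_nonneg_left (add_le_add h2 h1) h3
                linear_combination h4
              · ring_nf
            · simp only [hfdef, Set.indicator_of_notMem hG, mul_zero]
              exact zero_le
        _ = _ := by
            rw [lintegral_add_left (by fun_prop), lintegral_const_mul _ (by fun_prop),
              lintegral_const_mul _ (by fun_prop),
              (hq z).lintegral_exp_revealedLogRatio (hmeas' z) hk, mul_one]
    refine (lintegral_mono hz).trans ?_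
    rw [lintegral_add_right _ (by fun_prop), lintegral_const_mul _
      (Measurable.lintegral_prod_right' (f := fun p : Vec d × SqMat d =>
        S.indicator (1 : Vec d × Vec d × SqMat d → ℝ≥0∞) (x, p.1, p.2)) (by fun_prop)),
      lintegral_const_mul _ (by fun_prop)]
    -- The remaining factor is the density of the scaled shift of the side information, of total
    -- mass one.
    have h1 := lintegral_add_stdGaussian ((1 + η) • (t • x)) (f := fun _ => 1) measurable_const
    simp only [lintegral_const, measure_univ, mul_one] at h1
    rw [← h1, mul_one]
  refine (lintegral_mono hxz).trans ?_
  rw [lintegral_add_right _ measurable_const, lintegral_const, measure_univ, mul_one,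
    lintegral_const_mul' _ _ ENNReal.ofReal_ne_top]
  gcongr
  exact lintegral_spanEnergy_gt_le hmeas (k + 1) hs0 hs B'

end SpikedModel

/-! ### Numerical bounds for the energy levels. -/

section Numerics

/-- The fraction of the energy of the signal that is captured after `k` rounds, for the gap `δ`. -/
noncomputable def energyLevel (δ : ℝ) (k : ℕ) : ℝ := δ ^ 2 * k * Real.exp (5 * δ / 2) ^ k

lemma energyLevel_zero (δ : ℝ) : energyLevel δ 0 = 0 := by simp [energyLevel]

lemma energyLevel_nonneg (δ : ℝ) (k : ℕ) : 0 ≤ energyLevel δ k := by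
  unfold energyLevel
  positivity

/-- The inner factor `1 + δ / 4` allows for the norm of the signal, the outer one is slack for the
tail bounds. In total `(1 + δ / 4)² (1 + δ)² ≤ exp (5 δ / 2)`, the growth rate of the levels. -/
lemma le_energyLevel_succ {δ : ℝ} (hδ : 0 < δ) (k : ℕ) :
    (1 + δ / 4) * ((1 + δ / 4) * (δ ^ 2 + (1 + δ) ^ 2 * energyLevel δ k)) ≤
      energyLevel δ (k + 1) := by
  unfold energyLevel
  set E := Real.exp (5 * δ / 2) with hE
  have h1 : (1 + δ / 4) * (1 + δ / 4) * (1 + δ) ^ 2 ≤ E := by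
    have h2 := Real.add_one_le_exp (δ / 4)
    have h3 := Real.add_one_le_exp δ
    have h4 : E = Real.exp (δ / 4) * Real.exp (δ / 4) * Real.exp δ ^ 2 := by
      rw [hE, ← Real.exp_nat_mul, ← Real.exp_add, ← Real.exp_add]
      push_cast
      ring_nf
    rw [h4, add_comm 1, add_comm 1]
    gcongr
  have hE1 : 1 ≤ E := Real.one_le_exp (by positivity)
  have hEk : 1 ≤ E ^ k := one_le_pow₀ hE1
  have hk : (0 : ℝ) ≤ k := by positivity
  calc (1 + δ / 4) * ((1 + δ / 4) * (δ ^ 2 + (1 + δ) ^ 2 * (δ ^ 2 * k * E ^ k)))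
      ≤ (1 + δ / 4) * ((1 + δ / 4) * ((1 + δ) ^ 2 * (δ ^ 2 * E ^ k) +
          (1 + δ) ^ 2 * (δ ^ 2 * k * E ^ k))) := by
        gcongr
        have : 1 ≤ (1 + δ) ^ 2 := one_le_pow₀ (by linarith)
        calc δ ^ 2 = 1 * (δ ^ 2 * 1) := by ring
          _ ≤ _ := by gcongr
    _ = ((1 + δ / 4) * (1 + δ / 4) * (1 + δ) ^ 2) * (δ ^ 2 * (k + 1) * E ^ k) := by ring
    _ ≤ E * (δ ^ 2 * (k + 1) * E ^ k) := by gcongr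
    _ = _ := by push_cast; ring

/-- From `T + 1 ≤ 2 T` and `5 δ T ≤ 1` the accumulated growth is at most `e`. The output costs one
level beyond `T`, hence the factor two. -/
lemma energyLevel_succ_le {δ : ℝ} (hδ : 0 < δ) {T : ℕ} (hT : 1 ≤ T) (hTδ : T ≤ 1 / (5 * δ)) :
    energyLevel δ (T + 1) ≤ 2 * Real.exp 1 * δ ^ 2 * T := by
  have hT' : (1 : ℝ) ≤ T := by exact_mod_cast hT
  rw [le_div_iff₀ (by positivity)] at hTδ
  have h1 : Real.exp (5 * δ / 2) ^ (T + 1) ≤ Real.exp 1 := by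
    rw [← Real.exp_nat_mul]
    apply Real.exp_le_exp.2
    push_cast
    nlinarith
  unfold energyLevel
  calc δ ^ 2 * ((T + 1 : ℕ) : ℝ) * Real.exp (5 * δ / 2) ^ (T + 1)
      ≤ δ ^ 2 * (2 * T) * Real.exp 1 := by
        gcongr
        push_cast
        linarith
    _ = _ := by ring

lemma inv_sqrt_pow_le_exp {δ : ℝ} (hδ : 0 < δ) (hδ5 : δ ≤ 1 / 5) {n : ℕ}
    (hn : n ≤ 2 / (5 * δ)) :
    (Real.sqrt (1 - (1 + 3 * (δ / 16)) / (1 + δ / 4)))⁻¹ ^ n ≤ Real.exp (7 / δ ^ 2) := by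
  have h0 : (0 : ℝ) < 1 + δ / 4 := by linarith
  have h1 : 1 - (1 + 3 * (δ / 16)) / (1 + δ / 4) = δ / 16 / (1 + δ / 4) := by
    field_simp
    ring
  have h2 : (Real.sqrt (1 - (1 + 3 * (δ / 16)) / (1 + δ / 4)))⁻¹ ≤ Real.exp (16 / δ) := by
    rw [h1, ← Real.sqrt_inv, Real.sqrt_le_left (Real.exp_nonneg _), ← Real.exp_nat_mul]
    refine le_trans ?_ (Real.add_one_le_exp _)
    push_cast
    rw [inv_div, div_le_iff₀ (by positivity)]
    have : (2 * (16 / δ) + 1) * (δ / 16) = 2 + δ / 16 := by field_simp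
    rw [this]
    linarith
  calc _ ≤ Real.exp (16 / δ) ^ n := by gcongr
    _ ≤ _ := by
      rw [← Real.exp_nat_mul]
      apply Real.exp_le_exp.2
      calc (n : ℝ) * (16 / δ) ≤ 2 / (5 * δ) * (16 / δ) := by gcongr
        _ = (32 / 5) / δ ^ 2 := by field_simp; ring
        _ ≤ 7 / δ ^ 2 := by gcongr; norm_num

/-- The costs to absorb, `7 / δ²` and the logarithm of the number of rounds, are of order at most `1
/ δ²`. The weakest relevant exponent `d δ⁴` equals `(d δ⁶) / δ²`, so a large `d δ⁶` suffices. -/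
lemma sum_exp_le {δ d : ℝ} (hδ : 0 < δ) (hδ5 : δ ≤ 1 / 5) {T : ℕ} (hT : 1 ≤ T)
    (hTδ : T ≤ 1 / (5 * δ)) (hd : 1024 ≤ d * δ ^ 6) :
    (T + 1) * (Real.exp (7 / δ ^ 2 - d * δ ^ 3 / 32) + Real.exp (-(d * δ ^ 4 / 512))) +
      Real.exp (-(d * δ ^ 2 / 128)) ≤ 3 * Real.exp (-(d * δ ^ 6 / 1024)) := by
  have hT' : (1 : ℝ) ≤ T := by exact_mod_cast hT
  set D := d * δ ^ 6 with hD
  have hδ1 : 1 ≤ 1 / δ := by rw [le_div_iff₀ hδ]; linarith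
  set r := 1 / δ with hr
  have e2 : 7 / δ ^ 2 = 7 * r ^ 2 := by rw [hr]; field_simp
  have e3 : d * δ ^ 3 = D * r ^ 3 := by rw [hr, hD]; field_simp
  have e4 : d * δ ^ 4 = D * r ^ 2 := by rw [hr, hD]; field_simp
  have e5 : d * δ ^ 2 = D * r ^ 4 := by rw [hr, hD]; field_simp
  have hr2 : 1 ≤ r ^ 2 := one_le_pow₀ hδ1
  have hr3 : r ^ 2 ≤ r ^ 3 := pow_le_pow_right₀ hδ1 (by norm_num)
  have hr4 : 1 ≤ r ^ 4 := one_le_pow₀ hδ1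
  have hTr : (T : ℝ) + 1 ≤ Real.exp (r ^ 2) := by
    refine le_trans ?_ (Real.add_one_le_exp _)
    have h1 : (1 : ℝ) / (5 * δ) = r / 5 := by rw [hr]; field_simp
    rw [h1] at hTδ
    nlinarith
  have h1 : (T + 1) * Real.exp (7 / δ ^ 2 - d * δ ^ 3 / 32) ≤ Real.exp (-(D / 1024)) := by
    calc _ ≤ Real.exp (r ^ 2) * Real.exp (7 / δ ^ 2 - d * δ ^ 3 / 32) := by gcongr
      _ ≤ _ := by
        rw [← Real.exp_add, e2, e3]
        apply Real.exp_le_exp.2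
        have : 1024 * r ^ 3 ≤ D * r ^ 3 := by gcongr
        have : D * 1 ≤ D * r ^ 3 := by
          gcongr
          linarith
        nlinarith
  have h2 : (T + 1) * Real.exp (-(d * δ ^ 4 / 512)) ≤ Real.exp (-(D / 1024)) := by
    calc _ ≤ Real.exp (r ^ 2) * Real.exp (-(d * δ ^ 4 / 512)) := by gcongr
      _ ≤ _ := by
        rw [← Real.exp_add, e4]
        apply Real.exp_le_exp.2
        have : 1024 * r ^ 2 ≤ D * r ^ 2 := by gcongr
        have : D * 1 ≤ D * r ^ 2 := by gcongr
        nlinarith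
  have h3 : Real.exp (-(d * δ ^ 2 / 128)) ≤ Real.exp (-(D / 1024)) := by
    rw [e5]
    apply Real.exp_le_exp.2
    have : D * 1 ≤ D * r ^ 4 := by gcongr
    linarith
  linarith

end Numerics

/-! ### The energy recursion and the union bound over rounds. -/

section SpikedModel

variable {d : ℕ} {q : ℕ → Vec d → SqMat d → Vec d} {T : ℕ}

lemma lintegral_jumpEvent_energyLevel_le {δ : ℝ} (hδ : 0 < δ) (hδ5 : δ ≤ 1 / 5)
    (hq : ∀ b, Nonanticipating (fun j G => q j b G) T)
    (hmeas : ∀ j, Measurable fun p : Vec d × SqMat d => q j p.1 p.2) (hd : 1 ≤ d) (hT : 1 ≤ T)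
    (hTδ : T ≤ 1 / (5 * δ)) {k : ℕ} (hk : k ≤ T) :
    ∫⁻ x, ∫⁻ z, ∫⁻ G, (jumpEvent q k ((1 + δ / 4) * d) (energyLevel δ k * d)
        (energyLevel δ (k + 1) * d)).indicator 1
          (x, z + δ • x, G + ((1 + δ) / Real.sqrt (2 * d)) • outerSq x)
      ∂(stdGaussian (SqMat d)) ∂(stdGaussian (Vec d)) ∂(stdGaussian (Vec d)) ≤
      ENNReal.ofReal (Real.exp (7 / δ ^ 2 - d * δ ^ 3 / 32) + Real.exp (-(d * δ ^ 4 / 512))) := by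
  have hd' : (1 : ℝ) ≤ d := by exact_mod_cast hd
  -- `σ d` is exactly the information `t² A + 2 c² A B` available before the round.
  set σ := (1 + δ / 4) * (δ ^ 2 + (1 + δ) ^ 2 * energyLevel δ k) with hσ
  have hτ := energyLevel_nonneg δ k
  have hσδ : δ ^ 2 ≤ σ := by
    have h1 : 0 ≤ (1 + δ) ^ 2 * energyLevel δ k := by positivity
    calc δ ^ 2 = 1 * (δ ^ 2 + 0) := by ring
      _ ≤ σ := by
        rw [hσ]
        gcongr
        linarith
  have hσ1 : (1 + δ / 4) * σ ≤ energyLevel δ (k + 1) := le_energyLevel_succ hδ k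
  -- With `η = δ / 16` the slack is `1 + 4 η`. The threshold `θ` sits at `1 + 2 η` and the tail
  -- exponent `s B'` reaches `(1 + 3 η) σ d`: the tail beats `exp θ` by `η σ d / 2`, and the
  -- truncated moment gains `η² σ d / 2`.
  set s := (1 + 3 * (δ / 16)) / (1 + δ / 4) with hs
  have hs1 : s < 1 := by
    rw [hs, div_lt_one (by linarith)]
    linarith
  have hs0 : 0 ≤ s := by positivity
  set θ := d * (1 + 2 * (δ / 16)) * σ / 2 with hθ
  refine (lintegral_jumpEvent_le hq hmeas hk (θ := θ) hs0 hs1 (η := δ / 16)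
    (by positivity)).trans ?_
  rw [← ENNReal.ofReal_mul (Real.exp_nonneg _), ← ENNReal.ofReal_add (by positivity)
    (by positivity)]
  refine ENNReal.ofReal_le_ofReal (add_le_add ?_ (Real.exp_le_exp.2 ?_))
  · have hn : ((k + 1 : ℕ) : ℝ) ≤ 2 / (5 * δ) := by
      have h1 : ((k + 1 : ℕ) : ℝ) ≤ 2 * T := by
        have : k + 1 ≤ 2 * T := by omega
        exact_mod_cast this
      calc ((k + 1 : ℕ) : ℝ) ≤ 2 * (1 / (5 * δ)) := by linarith
        _ = _ := by ring
    have hK := inv_sqrt_pow_le_exp hδ hδ5 hn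
    have hsB : (1 + 3 * (δ / 16)) * σ * d ≤ s * (energyLevel δ (k + 1) * d) := by
      calc (1 + 3 * (δ / 16)) * σ * d = s * ((1 + δ / 4) * σ * d) := by
            rw [hs]
            field_simp
        _ ≤ _ := by gcongr
    calc _ ≤ Real.exp θ * (Real.exp (7 / δ ^ 2) *
          Real.exp (-(s * (energyLevel δ (k + 1) * d) / 2))) := by gcongr
      _ ≤ _ := by
        rw [← Real.exp_add, ← Real.exp_add]
        apply Real.exp_le_exp.2
        have : δ ^ 2 * (δ * d) ≤ σ * (δ * d) := by gcongr
        rw [hθ]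
        linarith
  · have h1 : ((1 + δ) / Real.sqrt (2 * d)) ^ 2 = (1 + δ) ^ 2 / (2 * d) := by
      rw [div_pow, Real.sq_sqrt (by positivity)]
    have h2 : δ ^ 2 * ((1 + δ / 4) * d) + 2 * ((1 + δ) / Real.sqrt (2 * d)) ^ 2 *
        ((1 + δ / 4) * d) * (energyLevel δ k * d) = σ * d := by
      rw [h1, hσ]
      field_simp
    rw [h2, hθ]
    have : δ ^ 2 * (δ ^ 2 * d) ≤ σ * (δ ^ 2 * d) := by gcongr
    linarith

/-- If the energy of the signal ends up above the last level, then its norm is large or it jumps in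
some round. -/
lemma indicator_spanEnergy_gt_le (q : ℕ → Vec d → SqMat d → Vec d) (A : ℝ) (B : ℕ → ℝ)
    (hB : 0 ≤ B 0) (T : ℕ) (x b : Vec d) (G : SqMat d) :
    {ω : Vec d × Vec d × SqMat d | B (T + 1) <
        spanEnergy (fun j => q j ω.2.1 ω.2.2) (T + 1) ω.1}.indicator
          (1 : Vec d × Vec d × SqMat d → ℝ≥0∞) (x, b, G) ≤
      ∑ k ∈ Finset.range (T + 1), (jumpEvent q k A (B k) (B (k + 1))).indicator 1 (x, b, G) +
        {x : Vec d | A < ‖x‖ ^ 2}.indicator 1 x := by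
  by_cases hS : B (T + 1) < spanEnergy (fun j => q j b G) (T + 1) x
  swap
  · rw [Set.indicator_of_notMem (by exact hS)]
    exact zero_le
  by_cases hx : A < ‖x‖ ^ 2
  · rw [Set.indicator_of_mem (by exact hS), Set.indicator_of_mem (s := {x : Vec d | A < ‖x‖ ^ 2})
      (by exact hx)]
    exact le_add_self
  have : ∃ k ∈ Finset.range (T + 1), (x, b, G) ∈ jumpEvent q k A (B k) (B (k + 1)) := by
    -- Without a jump the levels propagate by induction from zero energy to the last round.
    by_contra! hno
    have hall : ∀ k ≤ T + 1, spanEnergy (fun j => q j b G) k x ≤ B k := by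
      intro k
      induction k with
      | zero => simpa [spanEnergy_zero] using hB
      | succ k ih =>
        intro hk
        by_contra! hlt
        exact hno k (Finset.mem_range.2 (by omega)) ⟨not_lt.1 hx, ih (by omega), hlt⟩
    exact absurd hS (not_lt.2 (hall (T + 1) le_rfl))
  obtain ⟨k, hk, hkJ⟩ := this
  rw [Set.indicator_of_mem (by exact hS)]
  refine le_trans ?_ le_self_add
  refine le_trans (le_of_eq ?_) (Finset.single_le_sum (f := fun k =>
    (jumpEvent q k A (B k) (B (k + 1))).indicator (1 : Vec d × Vec d × SqMat d → ℝ≥0∞) (x, b, G))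
      (fun _ _ => zero_le) hk)
  simp only [Set.indicator_of_mem hkJ, Pi.one_apply]

lemma lintegral_lintegral_lintegral_sum {α β γ ι : Type*} [MeasurableSpace α] [MeasurableSpace β]
    [MeasurableSpace γ] (μ : Measure α) (ν : Measure β) (ρ : Measure γ) [SFinite ν] [SFinite ρ]
    (s : Finset ι) {f : ι → (α × β) × γ → ℝ≥0∞} (hf : ∀ i, Measurable (f i)) :
    ∫⁻ x, ∫⁻ y, ∫⁻ z, ∑ i ∈ s, f i ((x, y), z) ∂ρ ∂ν ∂μ =
      ∑ i ∈ s, ∫⁻ x, ∫⁻ y, ∫⁻ z, f i ((x, y), z) ∂ρ ∂ν ∂μ := by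
  have h1 : ∀ i, Measurable fun p : α × β => ∫⁻ z, f i (p, z) ∂ρ := fun i =>
    (hf i).lintegral_prod_right'
  have h2 : ∀ i, Measurable fun x : α => ∫⁻ y, ∫⁻ z, f i ((x, y), z) ∂ρ ∂ν := fun i =>
    (h1 i).lintegral_prod_right'
  rw [← lintegral_finsetSum _ fun i _ => h2 i]
  refine lintegral_congr fun x => ?_
  refine Eq.trans ?_ (lintegral_finsetSum _ fun i _ =>
    (h1 i).comp (measurable_prodMk_left (x := x)))
  refine lintegral_congr fun y => ?_
  exact lintegral_finsetSum _ fun i _ => (hf i).comp (measurable_prodMk_left (x := (x, y)))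

/-- Nonanticipating queries to the spiked matrix do not find the spike. -/
lemma lintegral_spanEnergy_gt_energyLevel_le {δ : ℝ} (hδ : 0 < δ) (hδ5 : δ ≤ 1 / 5)
    (hq : ∀ b, Nonanticipating (fun j G => q j b G) T)
    (hmeas : ∀ j, Measurable fun p : Vec d × SqMat d => q j p.1 p.2) (hd : 1 ≤ d) (hT : 1 ≤ T)
    (hTδ : T ≤ 1 / (5 * δ)) :
    ∫⁻ x, ∫⁻ z, ∫⁻ G, {ω : Vec d × Vec d × SqMat d | energyLevel δ (T + 1) * d <
        spanEnergy (fun j => q j ω.2.1 ω.2.2) (T + 1) ω.1}.indicator 1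
          (x, z + δ • x, G + ((1 + δ) / Real.sqrt (2 * d)) • outerSq x)
      ∂(stdGaussian (SqMat d)) ∂(stdGaussian (Vec d)) ∂(stdGaussian (Vec d)) ≤
      ENNReal.ofReal (3 * Real.exp (-(d * δ ^ 6 / 1024))) := by
  set S := {ω : Vec d × Vec d × SqMat d | energyLevel δ (T + 1) * d <
        spanEnergy (fun j => q j ω.2.1 ω.2.2) (T + 1) ω.1}
  -- For small `d δ⁶` the claimed bound exceeds `3 / e > 1` and is trivial.
  rcases lt_or_ge ((d : ℝ) * δ ^ 6) 1024 with hsmall | hlarge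
  · calc _ ≤ ∫⁻ _, ∫⁻ _, ∫⁻ _, 1
        ∂(stdGaussian (SqMat d)) ∂(stdGaussian (Vec d)) ∂(stdGaussian (Vec d)) := by
          gcongr
          exact Set.indicator_le_self' (fun _ _ => zero_le) _
      _ = ENNReal.ofReal 1 := by simp
      _ ≤ _ := by
        refine ENNReal.ofReal_le_ofReal ?_
        have h1 : Real.exp (-1) ≤ Real.exp (-((d : ℝ) * δ ^ 6 / 1024)) :=
          Real.exp_le_exp.2 (by linarith)
        have h2 : 1 ≤ 3 * Real.exp (-1) := by
          rw [Real.exp_neg, ← div_eq_mul_inv, le_div_iff₀ (Real.exp_pos 1)]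
          linarith [Real.exp_one_lt_d9]
        linarith
  set c := (1 + δ) / Real.sqrt (2 * d)
  set J : ℕ → Set (Vec d × Vec d × SqMat d) := fun k => jumpEvent q k ((1 + δ / 4) * d)
    (energyLevel δ k * d) (energyLevel δ (k + 1) * d) with hJ
  have hJm : ∀ k, Measurable ((J k).indicator (1 : Vec d × Vec d × SqMat d → ℝ≥0∞)) := fun k =>
    measurable_one.indicator (measurableSet_jumpEvent hmeas k _ _ _)
  set N : Set (Vec d) := {x | (1 + δ / 4) * d < ‖x‖ ^ 2}
  have hN : MeasurableSet N := measurableSet_lt measurable_const (by fun_prop)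
  have hcover : ∀ x b G, S.indicator (1 : Vec d × Vec d × SqMat d → ℝ≥0∞) (x, b, G) ≤
      ∑ k ∈ Finset.range (T + 1), (J k).indicator 1 (x, b, G) + N.indicator 1 x :=
    indicator_spanEnergy_gt_le q ((1 + δ / 4) * d) (fun k => energyLevel δ k * d)
      (by simp [energyLevel_zero]) T
  have ho := measurable_outerSq (d := d)
  have hJm' : ∀ k, Measurable fun ω : (Vec d × Vec d) × SqMat d => (J k).indicator
      (1 : Vec d × Vec d × SqMat d → ℝ≥0∞) (ω.1.1, ω.1.2 + δ • ω.1.1, ω.2 + c • outerSq ω.1.1) :=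
    fun k => (hJm k).comp (by fun_prop)
  calc _ ≤ ∫⁻ x, ∫⁻ z, ∫⁻ G, (∑ k ∈ Finset.range (T + 1), (J k).indicator
          (1 : Vec d × Vec d × SqMat d → ℝ≥0∞) (x, z + δ • x, G + c • outerSq x) +
          N.indicator 1 x)
        ∂(stdGaussian (SqMat d)) ∂(stdGaussian (Vec d)) ∂(stdGaussian (Vec d)) := by
        gcongr
        exact hcover _ _ _
    _ = ∑ k ∈ Finset.range (T + 1), ∫⁻ x, ∫⁻ z, ∫⁻ G, (J k).indicator
          (1 : Vec d × Vec d × SqMat d → ℝ≥0∞) (x, z + δ • x, G + c • outerSq x)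
        ∂(stdGaussian (SqMat d)) ∂(stdGaussian (Vec d)) ∂(stdGaussian (Vec d)) +
        stdGaussian (Vec d) N := by
        simp_rw [lintegral_add_right _ measurable_const, lintegral_const, measure_univ, mul_one]
        rw [lintegral_add_right _ (measurable_one.indicator hN), lintegral_indicator_one hN]
        congr 1
        exact lintegral_lintegral_lintegral_sum _ _ _ _ hJm'
    _ ≤ ∑ k ∈ Finset.range (T + 1), ENNReal.ofReal
          (Real.exp (7 / δ ^ 2 - d * δ ^ 3 / 32) + Real.exp (-(d * δ ^ 4 / 512))) +
          ENNReal.ofReal (Real.exp (-(d * (δ / 4) ^ 2 / 8))) := by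
        gcongr with k hk
        · exact lintegral_jumpEvent_energyLevel_le hδ hδ5 hq hmeas hd hT hTδ
            (by rw [Finset.mem_range] at hk; omega)
        · exact stdGaussian_norm_sq_gt_le (by positivity) (by linarith)
    _ = ENNReal.ofReal ((T + 1) * (Real.exp (7 / δ ^ 2 - d * δ ^ 3 / 32) +
          Real.exp (-(d * δ ^ 4 / 512))) + Real.exp (-(d * δ ^ 2 / 128))) := by
        rw [Finset.sum_const, Finset.card_range, nsmul_eq_mul, ← ENNReal.ofReal_natCast,
          ← ENNReal.ofReal_mul (by positivity), ← ENNReal.ofReal_add (by positivity)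
          (by positivity)]
        push_cast
        ring_nf
    _ ≤ _ := ENNReal.ofReal_le_ofReal (sum_exp_le hδ hδ5 hT hTδ hlarge)

end SpikedModel

/-! ### Query algorithms as nonanticipating sequences. -/

section Queries

variable {d T : ℕ} {Ξ : Type*} [MeasurableSpace Ξ]

lemma measurable_toEuclideanLin {Ω : Type*} [MeasurableSpace Ω] {A : Ω → Matrix (Fin d) (Fin d) ℝ}
    (hA : ∀ i j, Measurable fun ω => A ω i j) {v : Ω → Vec d} (hv : Measurable v) :
    Measurable fun ω => Matrix.toEuclideanLin (A ω) (v ω) := by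
  simp only [Matrix.toLpLin_apply]
  refine (WithLp.measurable_toLp 2 _).comp (measurable_pi_iff.2 fun i => ?_)
  simp only [Matrix.mulVec, dotProduct]
  have hc : ∀ c, Measurable fun ω => (v ω).ofLp c := fun c => by fun_prop
  exact Finset.measurable_sum _ fun c _ => (hA i c).mul (hc c)

namespace RQA

lemma measurable_history (Alg : RQA d T Ξ) {Ω : Type*} [MeasurableSpace Ω]
    {A : Ω → Matrix (Fin d) (Fin d) ℝ} (hA : ∀ i j, Measurable fun ω => A ω i j)
    {b : Ω → Vec d} (hb : Measurable b) {ξ : Ω → Ξ} (hξ : Measurable ξ) (k : ℕ) (hk : k ≤ T) :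
    Measurable fun ω => Alg.history (A ω) (b ω) (ξ ω) k hk := by
  induction k with
  | zero => exact measurable_pi_iff.2 fun i => i.elim0
  | succ k ih =>
    have ih' := ih (Nat.le_of_succ_le hk)
    have hv : Measurable fun ω => Alg.query ⟨k, hk⟩ (b ω)
        (Alg.history (A ω) (b ω) (ξ ω) k (Nat.le_of_succ_le hk)) (ξ ω) :=
      (Alg.measurable_query ⟨k, hk⟩).comp (hb.prodMk (ih'.prodMk hξ))
    refine measurable_pi_iff.2 fun i => ?_
    simp only [history]
    induction i using Fin.lastCases with
    | last =>
      simp only [Fin.snoc_last]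
      exact hv.prodMk (measurable_toEuclideanLin hA hv)
    | cast i =>
      simp only [Fin.snoc_castSucc]
      exact (measurable_pi_apply i).comp ih'

lemma measurable_run (Alg : RQA d T Ξ) {Ω : Type*} [MeasurableSpace Ω]
    {A : Ω → Matrix (Fin d) (Fin d) ℝ} (hA : ∀ i j, Measurable fun ω => A ω i j)
    {b : Ω → Vec d} (hb : Measurable b) {ξ : Ω → Ξ} (hξ : Measurable ξ) :
    Measurable fun ω => Alg.run (A ω) (b ω) (ξ ω) :=
  Alg.measurable_output.comp (hb.prodMk ((Alg.measurable_history hA hb hξ T le_rfl).prodMk hξ))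

end RQA

/-- The matrix `a I - (N + Nᵀ) / √(2 d)`. -/
noncomputable def shiftedSymmetrization (a : ℝ) (N : SqMat d) : Matrix (Fin d) (Fin d) ℝ :=
  a • (1 : Matrix (Fin d) (Fin d) ℝ) - Matrix.of (symmetrize N)

lemma measurable_shiftedSymmetrization (a : ℝ) (i j : Fin d) :
    Measurable fun N : SqMat d => shiftedSymmetrization a N i j := by
  simp only [shiftedSymmetrization, Matrix.sub_apply, Matrix.of_apply, symmetrize]
  fun_prop

lemma measurable_instanceMatrix (lam : ℝ) (i j : Fin d) :
    Measurable fun ω : Vec d × (Fin d → Fin d → ℝ) => instanceMatrix lam ω.1 ω.2 i j := by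
  have hi : ∀ i, Measurable fun ω : Vec d × (Fin d → Fin d → ℝ) => ω.1.ofLp i :=
    fun i => by fun_prop
  have hW : Measurable fun ω : Vec d × (Fin d → Fin d → ℝ) => ω.2 i j := by fun_prop
  simp only [instanceMatrix, deformedWigner, Matrix.sub_apply, Matrix.add_apply,
    Matrix.smul_apply, Matrix.vecMulVec_apply, Matrix.of_apply, smul_eq_mul]
  exact measurable_const.sub ((((hi i).mul (hi j)).const_mul _).add hW)

lemma instanceMatrix_eq_shiftedSymmetrization (hd : 1 ≤ d) (lam : ℝ) (x : Vec d) (G : SqMat d) :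
    instanceMatrix lam ((Real.sqrt d)⁻¹ • x) (symmetrize G) =
      shiftedSymmetrization (2 * (lam + lam⁻¹) - 2)
        (G + (lam / Real.sqrt (2 * d)) • outerSq x) := by
  have hd' : (0 : ℝ) < d := by exact_mod_cast hd
  rw [instanceMatrix, shiftedSymmetrization, deformedWigner]
  congr 1
  ext i j
  have h1 : (Real.sqrt d)⁻¹ * (Real.sqrt d)⁻¹ = 1 / d := by
    rw [← mul_inv, Real.mul_self_sqrt hd'.le, one_div]
  have h2 : (Real.sqrt (2 * d))⁻¹ * (Real.sqrt (2 * d))⁻¹ = 1 / (2 * d) := by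
    rw [← mul_inv, Real.mul_self_sqrt (by positivity), one_div]
  simp only [symmetrize, outerSq, Matrix.add_apply, Matrix.smul_apply, Matrix.vecMulVec_apply,
    Matrix.of_apply, PiLp.smul_apply, PiLp.add_apply, smul_eq_mul, div_eq_mul_inv]
  have h3 : (d : ℝ)⁻¹ = 2 * (1 / (2 * d)) := by field_simp
  rw [one_div, h3] at h1
  linear_combination lam * x i * x j * h1 - 2 * lam * x i * x j * h2

/-- Since `Q` is symmetric and kills `v`, both `Q N Q` and its transpose kill `v`. So `N v` and `Nᵀ
v`, and with them the response, are read off from `N - Q N Q`. -/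
lemma toEuclideanLin_shiftedSymmetrization_congr {Q : Matrix (Fin d) (Fin d) ℝ}
    (hQ : Q.transpose = Q) (a : ℝ) {N N' : SqMat d}
    (h : N - compress Q N = N' - compress Q N') {v : Vec d}
    (hv : Matrix.toEuclideanLin Q v = 0) :
    Matrix.toEuclideanLin (shiftedSymmetrization a N) v =
      Matrix.toEuclideanLin (shiftedSymmetrization a N') v := by
  have hv' : Q.mulVec v = 0 := by
    have := congrArg WithLp.ofLp hv
    simpa [Matrix.toLpLin_apply] using this
  have h1 : toMat N - Q * toMat N * Q = toMat N' - Q * toMat N' * Q := congrArg toMat h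
  have h2 : (toMat N).mulVec v = (toMat N').mulVec v := by
    have := congrArg (fun M => M.mulVec v) h1
    simpa [Matrix.sub_mulVec, ← Matrix.mulVec_mulVec, hv'] using this
  have h3 : (toMat N).transpose.mulVec v = (toMat N').transpose.mulVec v := by
    have := congrArg (fun M => M.transpose.mulVec v) h1
    simpa [Matrix.sub_mulVec, Matrix.transpose_mul, hQ, ← Matrix.mulVec_mulVec, hv'] using this
  have h4 : ∀ N : SqMat d, Matrix.of (symmetrize N) =
      (Real.sqrt (2 * d))⁻¹ • (toMat N + (toMat N).transpose) := fun N => rfl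
  simp only [Matrix.toLpLin_apply, shiftedSymmetrization, h4, Matrix.sub_mulVec,
    Matrix.smul_mulVec, Matrix.add_mulVec, h2, h3]

/-- The queries of an algorithm with seed `ξ`, and finally its output, as functions of the scaled
side information and of the matrix before symmetrization. -/
noncomputable def algQuery (Alg : RQA d T Ξ) (a : ℝ) (ξ : Ξ) (j : ℕ) (b : Vec d) (N : SqMat d) :
    Vec d :=
  if h : j < T then
    Alg.query ⟨j, h⟩ ((Real.sqrt d)⁻¹ • b)
      (Alg.history (shiftedSymmetrization a N) ((Real.sqrt d)⁻¹ • b) ξ j h.le) ξ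
  else Alg.run (shiftedSymmetrization a N) ((Real.sqrt d)⁻¹ • b) ξ

lemma measurable_algQuery (Alg : RQA d T Ξ) (a : ℝ) (ξ : Ξ) (j : ℕ) :
    Measurable fun p : Vec d × SqMat d => algQuery Alg a ξ j p.1 p.2 := by
  have hA : ∀ i j, Measurable fun p : Vec d × SqMat d => shiftedSymmetrization a p.2 i j :=
    fun i j => (measurable_shiftedSymmetrization a i j).comp measurable_snd
  have hb : Measurable fun p : Vec d × SqMat d => (Real.sqrt d)⁻¹ • p.1 := by fun_prop
  have hξ : Measurable fun _ : Vec d × SqMat d => ξ := measurable_const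
  unfold algQuery
  split_ifs with h
  · exact (Alg.measurable_query ⟨j, h⟩).comp
      (hb.prodMk ((Alg.measurable_history hA hb hξ j h.le).prodMk hξ))
  · exact Alg.measurable_run hA hb hξ

lemma nonanticipating_algQuery (Alg : RQA d T Ξ) (a : ℝ) (ξ : Ξ) (b : Vec d) :
    Nonanticipating (fun j N => algQuery Alg a ξ j b N) T := by
  intro k hk N N' h
  set Q := residualProj (fun j => algQuery Alg a ξ j b N) k with hQ
  have hhist : ∀ j (hj : j ≤ k),
      Alg.history (shiftedSymmetrization a N) ((Real.sqrt d)⁻¹ • b) ξ j (hj.trans hk) =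
        Alg.history (shiftedSymmetrization a N') ((Real.sqrt d)⁻¹ • b) ξ j (hj.trans hk) := by
    intro j
    induction j with
    | zero => intro _; rfl
    | succ j ih =>
      intro hj
      have ihj := ih (by omega)
      -- An earlier query is annihilated by the residual projection, so its response is determined
      -- by the revealed part.
      have hQv : Matrix.toEuclideanLin Q (algQuery Alg a ξ j b N) = 0 :=
        residualProj_apply_of_lt _ (by omega : j < k)
      have hA := toEuclideanLin_shiftedSymmetrization_congr (residualProj_transpose _ _) a h hQv
      rw [algQuery, dif_pos (by omega : j < T)] at hA
      simp only [RQA.history]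
      rw [← ihj, hA]
  intro j hj
  by_cases hjT : j < T
  · simp only [algQuery, dif_pos hjT, hhist j hj]
  -- The output appears only when `k = T`, where the whole history is already known to agree.
  · obtain rfl : j = T := by omega
    obtain rfl : k = j := by omega
    simp only [algQuery, dif_neg hjT, RQA.run, hhist k le_rfl]

/-- For every value of the seed, the output is unlikely to correlate with the plant. -/
lemma modelLaw_overlap_gt_le {lam : ℝ} (hlam : 1 < lam) (hlam5 : lam - 1 ≤ 1 / 5) (hd : 1 ≤ d)
    (hT : 1 ≤ T) (hTlam : T ≤ 1 / (5 * (lam - 1))) (Alg : RQA d T Ξ) (ξ : Ξ) :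
    modelLaw d ((lam - 1) ^ 2) {ω | 2 * Real.exp 1 * (lam - 1) ^ 2 * T <
        inner ℝ (unitVec (Alg.run (instanceMatrix lam ω.1.1 ω.1.2) ω.2 ξ)) ω.1.1 ^ 2} ≤
      ENNReal.ofReal (3 * Real.exp (-(d * (lam - 1) ^ 6 / 1024))) := by
  have hd' : (0 : ℝ) < d := by exact_mod_cast hd
  set δ := lam - 1 with hδdef
  have hδ : 0 < δ := by linarith
  set a := 2 * (lam + lam⁻¹) - 2 with ha
  set q := algQuery Alg a ξ with hqdef
  refine le_trans ?_ (lintegral_spanEnergy_gt_energyLevel_le (q := q) hδ hlam5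
    (nonanticipating_algQuery Alg a ξ) (measurable_algQuery Alg a ξ) hd hT hTlam)
  set S := {ω : (Vec d × (Fin d → Fin d → ℝ)) × Vec d | 2 * Real.exp 1 * δ ^ 2 * T <
        inner ℝ (unitVec (Alg.run (instanceMatrix lam ω.1.1 ω.1.2) ω.2 ξ)) ω.1.1 ^ 2}
  have hA : ∀ i j, Measurable fun ω : (Vec d × (Fin d → Fin d → ℝ)) × Vec d =>
      instanceMatrix lam ω.1.1 ω.1.2 i j := fun i j =>
    (measurable_instanceMatrix lam i j).comp measurable_fst
  have hS : MeasurableSet S := by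
    refine measurableSet_lt measurable_const (Measurable.pow_const (Measurable.inner ?_ ?_) 2)
    · exact measurable_unitVec.comp (Alg.measurable_run hA measurable_snd measurable_const)
    · exact measurable_fst.comp measurable_fst
  have hSm : Measurable (S.indicator (1 : (Vec d × (Fin d → Fin d → ℝ)) × Vec d → ℝ≥0∞)) :=
    measurable_one.indicator hS
  rw [← lintegral_indicator_one hS, lintegral_modelLaw d _ hSm, Real.sqrt_sq hδ.le]
  have hsym := measurable_symmetrize (d := d)
  refine lintegral_mono fun x => ?_
  rw [lintegral_lintegral_swap (f := fun G z => S.indicator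
    (1 : (Vec d × (Fin d → Fin d → ℝ)) × Vec d → ℝ≥0∞)
      (((Real.sqrt d)⁻¹ • x, symmetrize G), (Real.sqrt d)⁻¹ • (z + δ • x)))
    (Measurable.aemeasurable (by fun_prop))]
  refine lintegral_mono fun z => lintegral_mono fun G => ?_
  by_cases hmem : (((Real.sqrt d)⁻¹ • x, symmetrize G), (Real.sqrt d)⁻¹ • (z + δ • x)) ∈ S
  swap
  · simp only [Set.indicator_of_notMem hmem]
    exact zero_le
  have hmem' : (x, z + δ • x, G + ((1 + δ) / Real.sqrt (2 * d)) • outerSq x) ∈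
      {ω : Vec d × Vec d × SqMat d | energyLevel δ (T + 1) * d <
        spanEnergy (fun j => q j ω.2.1 ω.2.2) (T + 1) ω.1} := by
    change 2 * Real.exp 1 * δ ^ 2 * T < inner ℝ (unitVec (Alg.run (instanceMatrix lam
      ((Real.sqrt d)⁻¹ • x) (symmetrize G)) ((Real.sqrt d)⁻¹ • (z + δ • x)) ξ))
        ((Real.sqrt d)⁻¹ • x) ^ 2 at hmem
    rw [instanceMatrix_eq_shiftedSymmetrization hd, real_inner_smul_right, mul_pow, inv_pow,
      Real.sq_sqrt hd'.le, lt_inv_mul_iff₀ hd'] at hmem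
    -- The output has index `T`, so it is among the first `T + 1` vectors of the sequence.
    have h1 := inner_unitVec_sq_le_spanEnergy
      (fun j => q j (z + δ • x) (G + ((1 + δ) / Real.sqrt (2 * d)) • outerSq x))
      (Nat.lt_succ_self T) x
    have h2 : 1 + δ = lam := by rw [hδdef]; ring
    have h3 := energyLevel_succ_le hδ hT hTlam
    rw [hqdef, algQuery, dif_neg (lt_irrefl T), h2] at h1
    change energyLevel δ (T + 1) * d < spanEnergy (fun j => q j (z + δ • x)
      (G + ((1 + δ) / Real.sqrt (2 * d)) • outerSq x)) (T + 1) x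
    rw [h2]
    refine lt_of_lt_of_le ?_ h1
    refine lt_of_le_of_lt ?_ hmem
    rw [mul_comm]
    gcongr
  simp only [Set.indicator_of_mem hmem, Set.indicator_of_mem hmem', Pi.one_apply, le_refl]

end Queries

theorem theorem3 :
    ∃ c₁ c₂ c₃ c₄ : ℝ, 0 < c₁ ∧ 0 < c₂ ∧ 0 < c₃ ∧ 0 < c₄ ∧
      ∀ lam : ℝ, 1 < lam → lam ≤ 3 / 2 → ∀ τ₀ : ℝ, τ₀ = (lam - 1) ^ 2 →
      ∀ d T : ℕ, 1 ≤ d → 1 ≤ T → (T : ℝ) ≤ 1 / (5 * (lam - 1)) →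
      ∀ (Ξ : Type*) [MeasurableSpace Ξ] (ν : Measure Ξ) [IsProbabilityMeasure ν]
        (Alg : RQA d T Ξ),
        ((modelLaw d τ₀).prod ν)
            {ω | inner ℝ
                  (unitVec (Alg.run (instanceMatrix lam ω.1.1.1 ω.1.1.2) ω.1.2 ω.2)) ω.1.1.1 ^ 2
                > 2 * Real.exp 1 * τ₀ * T}
          ≤ ENNReal.ofReal (c₄ * Real.exp (-(c₁ * (d : ℝ) ^ c₂ * (lam - 1) ^ c₃))) := by
  refine ⟨1 / 1024, 1, 6, 3, by norm_num, by norm_num, by norm_num, by norm_num, ?_⟩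
  rintro lam hlam - τ₀ rfl d T hd hT hTlam Ξ _ ν _ Alg
  have hT' : (1 : ℝ) ≤ T := by exact_mod_cast hT
  -- A single allowed round already forces the gap to be at most `1 / 5`.
  have hlam5 : lam - 1 ≤ 1 / 5 := by
    have h := hT'.trans hTlam
    rw [le_div_iff₀ (by linarith)] at h
    linarith
  have : IsProbabilityMeasure (modelLaw d ((lam - 1) ^ 2)) := by
    unfold modelLaw
    infer_instance
  -- The seed is independent of the instance, so it is frozen first and the bound, uniform in it, is
  -- averaged.
  rw [Measure.prod_apply_symm]
  · calc _ ≤ ∫⁻ _, ENNReal.ofReal (3 * Real.exp (-(d * (lam - 1) ^ 6 / 1024))) ∂ν :=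
          lintegral_mono fun ξ => modelLaw_overlap_gt_le hlam hlam5 hd hT hTlam Alg ξ
      _ = ENNReal.ofReal (3 * Real.exp (-(1 / 1024 * (d : ℝ) ^ (1 : ℝ) * (lam - 1) ^ (6 : ℝ)))) := by
          rw [lintegral_const, measure_univ, mul_one, Real.rpow_one, Real.rpow_ofNat]
          ring_nf
  · refine measurableSet_lt measurable_const (Measurable.pow_const (Measurable.inner ?_ ?_) 2)
    · refine measurable_unitVec.comp (Alg.measurable_run (fun i j => ?_) (by fun_prop)
        measurable_snd)
      exact (measurable_instanceMatrix lam i j).comp (by fun_prop)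
    · fun_prop
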